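/- Work over $\mathbb C$. A \emph{p-family} is a sequence $(f_n)_{n\in\mathbb N}$ of polynomials in $\mathbb C[x_1,x_2,\ldots]$ such that the degree of $f_n$ and the number of variables occurring in $f_n$ are both bounded by a polynomial in $n$. A sequence $(c_n)$ of natural numbers is \emph{quasipolynomially bounded} if there is a polynomial $q$ with $c_n\le n^{q(\log_2 n)}$ for all $n\ge 2$. The size of a formula or circuit is its number of vertices. Let $\mathsf{VQF}$ and $\mathsf{VQP}$ be the classes of p-families with quasipolynomially bounded arithmetic formula size and circuit size, respectively (binary gates $+$ and $\times$; leaves labelled by affine linear polynomials). Let $\mathsf{VQBP}$ be the class of p-families for which $w(f_n)=\sum_d w(f_{n,d})$ is quasipolynomially bounded, where $f_{n,d}$ is the homogeneous degree $d$ component of $f_n$ and, for $p$ homogeneous of degree $d \geq 2$, $w(p)$ is the smallest $m$ such that $p$ is a product of $d$ matrices of formats $1\times m, m\times m,\ldots,m\times m,m\times 1$ with homogeneous linear entries; for $d\le 1$, $w(p)=1$ if $p\neq 0$ and $w(0)=0$. An \emph{input-homogeneous-linear (IHL) formula over the arity 3 basis} has leaves labelled by homogeneous linear polynomials, addition gates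 of arity $2$ and product gates of arity exactly $3$. An IHL circuit over the arity 3 basis is defined in the same way on a directed acyclic graph, where moreover every edge carries a scalar by which the forwarded polynomial is multiplied. A \emph{graded} IHL formula (respectively, circuit) over the arity 3 basis for $f$ is one of the form $$f \;=\; f(0)\;+\;\sum_{d\ \mathrm{odd}} f_d\;+\;\sum_{d\ge 2\ \mathrm{even}}\frac1d\sum_i x_i\cdot\frac{\partial f_d}{\partial x_i},$$ where $f_d$ is the homogeneous degree $d$ component of $f$, and each $f_d$ ($d$ odd) and each $\partial f_d/\partial x_i$ ($d\ge 2$ even) is computed by an IHL formula (respectively, circuit) over the arity 3 basis. Let $\mathsf{VQ3F}$ (respectively, $\mathsf{VQ3P}$) be the class of p-families for which the required size of graded IHL formulas (respectively, circuits) over the arity 3 basis is quasipolynomially bounded. Then $\mathsf{VQ3F}=\mathsf{VQ3P}$, and moreover $$\mathsf{VQ3F}=\mathsf{VQF}=\mathsf{VQBP}=\mathsf{VQP}=\mathsf{VQ3P}.$$ -/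

import Mathlib

namespace ArithComplexity

open MvPolynomial

/-- The polynomial ring `ℂ[x₀, x₁, x₂, …]` in countably many variables. -/
abbrev Poly := MvPolynomial ℕ ℂ

/-- A sequence of natural numbers is polynomially bounded. -/
def PolyBounded (m : ℕ → ℕ) : Prop :=
  ∃ t : Polynomial ℝ, ∀ n : ℕ, (m n : ℝ) ≤ t.eval (n : ℝ)

/-- A sequence of natural numbers is quasipolynomially bounded: for some polynomial `q`,
`c n ≤ n ^ q(log₂ n)` for all `n ≥ 2`. -/
def QuasiPolyBounded (c : ℕ → ℕ) : Prop :=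
  ∃ q : Polynomial ℝ, ∀ n : ℕ, 2 ≤ n → (c n : ℝ) ≤ (n : ℝ) ^ (q.eval (Real.logb 2 (n : ℝ)))

/-- A p-family: the degree and the number of occurring variables are polynomially bounded. -/
def IsPFamily (f : ℕ → Poly) : Prop :=
  PolyBounded (fun n => (f n).totalDegree) ∧ PolyBounded (fun n => (f n).vars.card)

/-! ### Ordinary formulas and circuits -/

/-- Arithmetic formulas: binary trees of additions and multiplications whose leaves are labelled by
affine linear polynomials. -/
inductive Formula : Type
  | leaf (l : Poly) (hl : l.totalDegree ≤ 1) : Formula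
  | add (F G : Formula) : Formula
  | mul (F G : Formula) : Formula

namespace Formula

/-- The polynomial computed by a formula. -/
noncomputable def eval : Formula → Poly
  | leaf l _ => l
  | add F G => F.eval + G.eval
  | mul F G => F.eval * G.eval

/-- The number of vertices of a formula. -/
def size : Formula → ℕ
  | leaf _ _ => 1
  | add F G => F.size + G.size + 1
  | mul F G => F.size + G.size + 1

end Formula

/-- A gate of an arithmetic circuit whose possible children are the gates numbered `0, …, n - 1`. -/
inductive Gate (n : ℕ) : Type
  | leaf (l : Poly) (hl : l.totalDegree ≤ 1) : Gate n
  | add (j k : Fin n) : Gate n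
  | mul (j k : Fin n) : Gate n

/-- An arithmetic circuit with `s` vertices, numbered in a topological order: the children of
gate `i` have smaller numbers than `i`. A gate may be used by any number of later gates. -/
structure Circuit (s : ℕ) where
  gate : (i : Fin s) → Gate i.val

namespace Circuit

/-- The polynomial computed at gate `i`. -/
noncomputable def val {s : ℕ} (C : Circuit s) (i : Fin s) : Poly :=
  match C.gate i with
  | .leaf l _ => l
  | .add j k => C.val ⟨j.val, j.isLt.trans i.isLt⟩ + C.val ⟨k.val, k.isLt.trans i.isLt⟩
  | .mul j k => C.val ⟨j.val, j.isLt.trans i.isLt⟩ * C.val ⟨k.val, k.isLt.trans i.isLt⟩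
termination_by i.val
decreasing_by all_goals simp

/-- The polynomial `p` is computed at some gate of the circuit. -/
def Computes {s : ℕ} (C : Circuit s) (p : Poly) : Prop := ∃ i, C.val i = p

end Circuit

/-- The formula complexity of `p` is at most `s`. -/
def FormulaSizeLE (p : Poly) (s : ℕ) : Prop :=
  ∃ F : Formula, F.eval = p ∧ F.size ≤ s

/-- The circuit complexity of `p` is at most `s`. -/
def CircuitSizeLE (p : Poly) (s : ℕ) : Prop :=
  ∃ r ≤ s, ∃ C : Circuit r, C.Computes p

/-! ### Homogeneous branching programs -/

/-- The homogeneous polynomial `p` of degree `d` is a product of `d` matrices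
of formats `1 × n, n × n, …, n × n, n × 1` with homogeneous linear entries (`d ≥ 2`).
In the degenerate degrees `0` and `1` (a scalar, a `1 × 1` matrix), the zero polynomial has
width `0` and every other polynomial has width `1`. -/
def HomWidthLE (n : ℕ) : ℕ → Poly → Prop
  | 0, p => p.IsHomogeneous 0 ∧ (p = 0 ∨ 1 ≤ n)
  | 1, p => p.IsHomogeneous 1 ∧ (p = 0 ∨ 1 ≤ n)
  | d + 2, p =>
    ∃ (u : Fin n → Poly) (A : Fin d → Matrix (Fin n) (Fin n) Poly) (v : Fin n → Poly),
      (∀ i, (u i).IsHomogeneous 1) ∧ (∀ k i j, (A k i j).IsHomogeneous 1) ∧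
      (∀ i, (v i).IsHomogeneous 1) ∧
      p = u ⬝ᵥ ((List.ofFn A).prod.mulVec v)

/-- The homogeneous branching program width of `p`, i.e. the sum of the widths of its homogeneous
components, is at most `s`. -/
def BPWidthLE (p : Poly) (s : ℕ) : Prop :=
  ∃ w : ℕ → ℕ,
    (∀ d ∈ Finset.range (p.totalDegree + 1), HomWidthLE (w d) d (homogeneousComponent d p)) ∧
    ∑ d ∈ Finset.range (p.totalDegree + 1), w d ≤ s

/-! ### Input-homogeneous-linear (IHL) computation over the arity 3 basis -/

/-- IHL formulas over the arity 3 basis: leaves are labelled by homogeneous linear polynomials,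
additions have arity 2, products have arity exactly 3. -/
inductive Formula3 : Type
  | leaf (l : Poly) (hl : l.IsHomogeneous 1) : Formula3
  | add (F G : Formula3) : Formula3
  | mul (F G H : Formula3) : Formula3

namespace Formula3

/-- The polynomial computed by a formula. -/
noncomputable def eval : Formula3 → Poly
  | leaf l _ => l
  | add F G => F.eval + G.eval
  | mul F G H => F.eval * G.eval * H.eval

/-- The number of vertices of a formula. -/
def size : Formula3 → ℕ
  | leaf _ _ => 1
  | add F G => F.size + G.size + 1
  | mul F G H => F.size + G.size + H.size + 1

end Formula3

/-- A gate of an IHL circuit over the arity 3 basis whose possible children are the gates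
numbered `0, …, n - 1`. Each edge carries a scalar: `add a j b k` computes `a • g_j + b • g_k`, and
`mul a j b k c l` computes `(a • g_j) * (b • g_k) * (c • g_l)`. -/
inductive Gate3 (n : ℕ) : Type
  | leaf (l : Poly) (hl : l.IsHomogeneous 1) : Gate3 n
  | add (a : ℂ) (j : Fin n) (b : ℂ) (k : Fin n) : Gate3 n
  | mul (a : ℂ) (j : Fin n) (b : ℂ) (k : Fin n) (c : ℂ) (l : Fin n) : Gate3 n

/-- An IHL circuit over the arity 3 basis with `s` vertices, numbered in a topological order. -/
structure Circuit3 (s : ℕ) where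
  gate : (i : Fin s) → Gate3 i.val

namespace Circuit3

/-- The polynomial computed at gate `i`. -/
noncomputable def val {s : ℕ} (C : Circuit3 s) (i : Fin s) : Poly :=
  match C.gate i with
  | .leaf l _ => l
  | .add a j b k =>
      a • C.val ⟨j.val, j.isLt.trans i.isLt⟩ + b • C.val ⟨k.val, k.isLt.trans i.isLt⟩
  | .mul a j b k c l =>
      (a • C.val ⟨j.val, j.isLt.trans i.isLt⟩) * (b • C.val ⟨k.val, k.isLt.trans i.isLt⟩) *
        (c • C.val ⟨l.val, l.isLt.trans i.isLt⟩)
termination_by i.val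
decreasing_by all_goals simp

/-- The polynomial `p` is computed at some gate of the circuit. -/
def Computes {s : ℕ} (C : Circuit3 s) (p : Poly) : Prop := ∃ i, C.val i = p

end Circuit3

/-- The odd degrees up to the degree of `f`. -/
def oddDegrees (f : Poly) : Finset ℕ :=
  (Finset.range (f.totalDegree + 1)).filter (fun d => d % 2 = 1)

/-- The even degrees, at least `2`, up to the degree of `f`. -/
def evenDegrees (f : Poly) : Finset ℕ :=
  (Finset.range (f.totalDegree + 1)).filter (fun d => d % 2 = 0 ∧ 2 ≤ d)

/-- The number of vertices in the top part of a graded IHL formula or circuit for `f`,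
`f = f(0) + ∑_{d odd} f_d + ∑_{d even, d ≥ 2} ∑_i (x_i / d) * ∂f_d/∂x_i`,
where `f_d` and `∂f_d/∂x_i` are computed below by IHL formulas or circuits over the arity 3 basis.
It consists of one leaf for the constant `f(0)`, a leaf for `x_i` and a binary product gate for each
pair `(d, i)`, and one binary addition for every summand but the first. -/
noncomputable def topSize (f : Poly) : ℕ :=
  1 + (oddDegrees f).card + 3 * ((evenDegrees f).card * f.vars.card)

/-- The graded IHL formula complexity of `f` over the arity 3 basis is at most `s`.
Here `F d` computes `f_d` (`d` odd) and `G d i` computes `∂f_d/∂x_i` (`d ≥ 2` even). -/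
def GradedFormulaSizeLE (f : Poly) (s : ℕ) : Prop :=
  ∃ (F : ℕ → Formula3) (G : ℕ → ℕ → Formula3),
    (∀ d ∈ oddDegrees f, (F d).eval = homogeneousComponent d f) ∧
    (∀ d ∈ evenDegrees f, ∀ i ∈ f.vars, (G d i).eval = pderiv i (homogeneousComponent d f)) ∧
    topSize f + ∑ d ∈ oddDegrees f, (F d).size +
      ∑ d ∈ evenDegrees f, ∑ i ∈ f.vars, (G d i).size ≤ s

/-- The graded IHL circuit complexity of `f` over the arity 3 basis is at most `s`. As in any
circuit, the gates may be shared between the computations of the various components. -/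
def GradedCircuitSizeLE (f : Poly) (s : ℕ) : Prop :=
  ∃ (r : ℕ) (C : Circuit3 r),
    (∀ d ∈ oddDegrees f, C.Computes (homogeneousComponent d f)) ∧
    (∀ d ∈ evenDegrees f, ∀ i ∈ f.vars, C.Computes (pderiv i (homogeneousComponent d f))) ∧
    topSize f + r ≤ s

/-! ### The classes -/

/-- The p-families for which a given complexity measure is quasipolynomially bounded, where
`L p s` expresses that the measure of `p` is at most `s`. -/
def quasiPolyClass (L : Poly → ℕ → Prop) : Set (ℕ → Poly) :=
  {f | IsPFamily f ∧ ∃ c : ℕ → ℕ, QuasiPolyBounded c ∧ ∀ n, L (f n) (c n)}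

/-- `VQF`: quasipolynomial formula size. -/
def VQF : Set (ℕ → Poly) := quasiPolyClass FormulaSizeLE

/-- `VQBP`: quasipolynomial homogeneous branching program width. -/
def VQBP : Set (ℕ → Poly) := quasiPolyClass BPWidthLE

/-- `VQP`: quasipolynomial circuit size. -/
def VQP : Set (ℕ → Poly) := quasiPolyClass CircuitSizeLE

/-- `VQ3F`: quasipolynomial size of graded IHL formulas over the arity 3 basis. -/
def VQ3F : Set (ℕ → Poly) := quasiPolyClass GradedFormulaSizeLE

/-- `VQ3P`: quasipolynomial size of graded IHL circuits over the arity 3 basis. -/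
def VQ3P : Set (ℕ → Poly) := quasiPolyClass GradedCircuitSizeLE

end ArithComplexity

namespace ArithComplexity

open MvPolynomial
open scoped Pointwise

/-! ### Spaces spanned by few polynomials, and chains of such spaces -/

/-! All classes are placed on the cycle VQP ⊆ VQBP ⊆ VQ3F ⊆ VQ3P ⊆ VQP, with the detour VQ3F ⊆ VQF ⊆
VQP. Only the first two inclusions cost more than a constant factor.

Branching programs are handled without coordinates: a homogeneous program of small width amounts to
a chain of spaces `T e` of degree `e` forms, each with few generators, where `T (e + 1)` lies in
(linear forms) · `T e` (`IsChain.homWidthLE`, `HomWidthLE.exists_chain`).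

From circuits to programs: let `V e` be the span of the degree `e` components of all gates. For `e ≥
2`, every element of `V e` is a sum of products from `V a * V b` with `a + b = e` and `a, b ≥ 1`
(`StraightLine.componentSpace_le`). One of the two factors has at most half the degree, so about
`log₂` of the degree many rounds of expansion turn `V` into a chain, each round multiplying the
number of generators by (degree + 1) · (size + 1) (`exists_chain_of_le_sup`). The width is
quasipolynomial.

From programs to ternary formulas: ternary products of linear forms produce only odd degrees. A
product of an odd number of matrices splits into three shorter products of odd length, and recursion
has logarithmic depth (`ternarySizeLE_list_prod`). In even degree `d` the partial derivatives have
odd degree `d - 1`; by the product rule they have programs of about twice the width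
(`HomWidthLE.pderiv`). Euler's identity recovers the component from them (`eq_sum_components`).

The remaining inclusions replace each ternary gate by a bounded number of binary ones, or read a
formula as a circuit. `quasiPolyBounded_of_le` absorbs all size losses. -/

/-- `U` is spanned by at most `t` polynomials. -/
def SpanLE (U : Submodule ℂ Poly) (t : ℕ) : Prop :=
  ∃ S : Finset Poly, S.card ≤ t ∧ Submodule.span ℂ (S : Set Poly) = U

theorem SpanLE.mono {U : Submodule ℂ Poly} {s t : ℕ} (h : SpanLE U s) (hst : s ≤ t) :
    SpanLE U t := by
  obtain ⟨S, hS, rfl⟩ := h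
  exact ⟨S, hS.trans hst, rfl⟩

theorem spanLE_bot (t : ℕ) : SpanLE ⊥ t := ⟨∅, by simp, by simp⟩

theorem spanLE_one : SpanLE 1 1 := ⟨{1}, by simp, by simp [Submodule.one_eq_span]⟩

theorem SpanLE.sup {U V : Submodule ℂ Poly} {s t : ℕ} (hU : SpanLE U s) (hV : SpanLE V t) :
    SpanLE (U ⊔ V) (s + t) := by
  classical
  obtain ⟨S, hS, rfl⟩ := hU
  obtain ⟨T, hT, rfl⟩ := hV
  refine ⟨S ∪ T, (Finset.card_union_le S T).trans (by omega), ?_⟩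
  rw [Finset.coe_union, Submodule.span_union]

theorem SpanLE.mul {U V : Submodule ℂ Poly} {s t : ℕ} (hU : SpanLE U s) (hV : SpanLE V t) :
    SpanLE (U * V) (s * t) := by
  classical
  obtain ⟨S, hS, rfl⟩ := hU
  obtain ⟨T, hT, rfl⟩ := hV
  refine ⟨S * T, Finset.card_mul_le.trans (Nat.mul_le_mul hS hT), ?_⟩
  rw [Finset.coe_mul, Submodule.span_mul_span]

theorem SpanLE.map {U : Submodule ℂ Poly} {s : ℕ} (hU : SpanLE U s) (φ : Poly →ₗ[ℂ] Poly) :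
    SpanLE (U.map φ) s := by
  classical
  obtain ⟨S, hS, rfl⟩ := hU
  exact ⟨S.image φ, Finset.card_image_le.trans hS, by rw [Finset.coe_image, Submodule.map_span]⟩

theorem spanLE_finset_sup {ι : Type*} (I : Finset ι) (U : ι → Submodule ℂ Poly) (t : ℕ)
    (h : ∀ i ∈ I, SpanLE (U i) t) : SpanLE (I.sup U) (I.card * t) := by
  classical
  induction I using Finset.induction_on with
  | empty => simpa using spanLE_bot 0
  | insert a I ha ih =>
    rw [Finset.sup_insert, Finset.card_insert_of_notMem ha]
    refine ((h a (by simp)).sup (ih fun i hi => h i (by simp [hi]))).mono ?_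
    rw [add_mul, one_mul, add_comm]

theorem spanLE_span_range {ι : Type*} [Fintype ι] (g : ι → Poly) :
    SpanLE (Submodule.span ℂ (Set.range g)) (Fintype.card ι) := by
  classical
  exact ⟨Finset.univ.image g, Finset.card_image_le, by simp⟩

theorem SpanLE.exists_range {U : Submodule ℂ Poly} {t : ℕ} (h : SpanLE U t) :
    ∃ P : Fin t → Poly, Submodule.span ℂ (Set.range P) = U := by
  obtain ⟨S, hS, rfl⟩ := h
  -- Indices beyond the number of generators are padded with `0`, so that the family has exactly `t`
  -- members.
  refine ⟨fun i => if hi : i.val < S.card then (S.equivFin.symm ⟨i, hi⟩ : Poly) else 0, ?_⟩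
  apply le_antisymm <;> rw [Submodule.span_le]
  · rintro _ ⟨i, rfl⟩
    by_cases hi : i.val < S.card
    · simpa [hi] using Submodule.subset_span (S.equivFin.symm ⟨i, hi⟩).2
    · simp [hi]
  · intro p hp
    refine Submodule.subset_span ⟨⟨S.equivFin ⟨p, hp⟩, (Fin.is_lt _).trans_le hS⟩, ?_⟩
    simp

/-- The space of homogeneous linear polynomials. -/
noncomputable abbrev linForms : Submodule ℂ Poly := homogeneousSubmodule ℕ ℂ 1

/-- A chain of spaces of homogeneous polynomials, each generated by its predecessor over the
linear forms. -/
structure IsChain (T : ℕ → Submodule ℂ Poly) : Prop where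
  zero_le : T 0 ≤ 1
  succ_le : ∀ e, T (e + 1) ≤ linForms * T e

theorem IsChain.one_le {T : ℕ → Submodule ℂ Poly} (hT : IsChain T) : T 1 ≤ linForms := by
  calc T 1 ≤ linForms * T 0 := hT.succ_le 0
    _ ≤ linForms * 1 := mul_le_mul' le_rfl hT.zero_le
    _ = linForms := mul_one _

theorem mem_linForms_mul_span_range {m : ℕ} (P : Fin m → Poly) {p : Poly}
    (hp : p ∈ linForms * Submodule.span ℂ (Set.range P)) :
    ∃ a : Fin m → Poly, (∀ i, (a i).IsHomogeneous 1) ∧ p = a ⬝ᵥ P := by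
  refine Submodule.mul_induction_on hp ?_ ?_
  · intro l hl q hq
    refine Submodule.span_induction ?_ ?_ ?_ ?_ hq
    · rintro _ ⟨i, rfl⟩
      refine ⟨Pi.single i l, fun j => ?_, by simp⟩
      by_cases hj : j = i
      · subst hj; simpa using hl
      · simpa [Pi.single_apply, hj] using isHomogeneous_zero ℕ ℂ 1
    · exact ⟨0, fun j => isHomogeneous_zero ℕ ℂ 1, by simp⟩
    · rintro x y - - ⟨a, ha, hax⟩ ⟨b, hb, hby⟩
      exact ⟨a + b, fun i => (ha i).add (hb i), by rw [mul_add, hax, hby, add_dotProduct]⟩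
    · rintro c x - ⟨a, ha, hax⟩
      refine ⟨c • a, fun i => (linForms.smul_mem c (ha i) : _), ?_⟩
      rw [mul_smul_comm, hax, smul_dotProduct]
  · rintro x y ⟨a, ha, rfl⟩ ⟨b, hb, rfl⟩
    exact ⟨a + b, fun i => (ha i).add (hb i), by rw [add_dotProduct]⟩

/-- Row `i` of a transition matrix lists the linear coefficients that express `P (e + 1) i` through
the generators one level below. Each new matrix is multiplied on the left. -/
theorem exists_matrix_of_chain {m : ℕ} (P : ℕ → Fin m → Poly)
    (hP : ∀ e i, P (e + 1) i ∈ linForms * Submodule.span ℂ (Set.range (P e))) (k d : ℕ) :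
    ∃ A : Fin d → Matrix (Fin m) (Fin m) Poly, (∀ k i j, (A k i j).IsHomogeneous 1) ∧
      P (k + d) = (List.ofFn A).prod.mulVec (P k) := by
  induction d with
  | zero => exact ⟨fun i => i.elim0, fun i => i.elim0, by simp⟩
  | succ d ih =>
    obtain ⟨A, hA, hPd⟩ := ih
    choose B hB hPB using fun i => mem_linForms_mul_span_range _ (hP (k + d) i)
    refine ⟨Fin.cons (Matrix.of B) A, Fin.cases hB hA, ?_⟩
    rw [List.ofFn_succ, List.prod_cons]
    simp only [Fin.cons_zero, Fin.cons_succ]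
    rw [← Matrix.mulVec_mulVec, ← hPd]
    funext i
    exact hPB i

theorem IsChain.isHomogeneous {T : ℕ → Submodule ℂ Poly} (hT : IsChain T) (e : ℕ) :
    T e ≤ homogeneousSubmodule ℕ ℂ e := by
  induction e with
  | zero =>
    refine hT.zero_le.trans ?_
    rw [Submodule.one_le]
    exact isHomogeneous_one ℕ ℂ
  | succ e ih =>
    refine (hT.succ_le e).trans ((mul_le_mul' le_rfl ih).trans ?_)
    rw [add_comm]
    exact homogeneousSubmodule_mul 1 e

theorem IsChain.homWidthLE {T : ℕ → Submodule ℂ Poly} (hT : IsChain T) {m d : ℕ}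
    (hm : 1 ≤ m) (hTm : ∀ e < d, SpanLE (T e) m) {p : Poly} (hp : p ∈ T d) :
    HomWidthLE m d p := by
  match d with
  | 0 => exact ⟨hT.isHomogeneous 0 hp, Or.inr hm⟩
  | 1 => exact ⟨hT.isHomogeneous 1 hp, Or.inr hm⟩
  | d + 2 =>
    -- Only the levels below the output have a bound on their generators; from there on `P` is set
    -- to `0`, which makes the successor relation hold at every level.
    have hrange : ∀ e, ∃ P : Fin m → Poly,
        (e < d + 2 → T e = Submodule.span ℂ (Set.range P)) ∧ (¬ e < d + 2 → P = 0) := by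
      intro e
      by_cases he : e < d + 2
      · obtain ⟨P, hP⟩ := (hTm e he).exists_range
        exact ⟨P, fun _ => hP.symm, fun h => absurd he h⟩
      · exact ⟨0, fun h => absurd h he, fun _ => rfl⟩
    choose P hPT hP0 using hrange
    have hPsucc : ∀ e i, P (e + 1) i ∈ linForms * Submodule.span ℂ (Set.range (P e)) := by
      intro e i
      by_cases he : e + 1 < d + 2
      · rw [← hPT e (by omega)]
        refine hT.succ_le e ?_
        rw [hPT (e + 1) he]
        exact Submodule.subset_span ⟨i, rfl⟩
      · rw [hP0 (e + 1) he]
        exact zero_mem _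
    obtain ⟨A, hA, hPd⟩ := exists_matrix_of_chain P hPsucc 1 d
    have hp' := hT.succ_le (d + 1) hp
    rw [hPT (d + 1) (by omega)] at hp'
    obtain ⟨u, hu, hup⟩ := mem_linForms_mul_span_range _ hp'
    refine ⟨u, A, P 1, hu, hA, fun i => ?_, ?_⟩
    · refine hT.one_le ?_
      rw [hPT 1 (by omega)]
      exact Submodule.subset_span ⟨i, rfl⟩
    · rw [hup, add_comm d 1, hPd]

/-- The partial products of a branching program for `p` span a chain of small spaces. -/
theorem HomWidthLE.exists_chain {m d : ℕ} (hd : 2 ≤ d) {p : Poly} (h : HomWidthLE m d p) :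
    ∃ T : ℕ → Submodule ℂ Poly, IsChain T ∧ (∀ e, SpanLE (T e) (m + 1)) ∧ p ∈ T d := by
  obtain ⟨d, rfl⟩ := Nat.exists_eq_add_of_le' hd
  obtain ⟨u, A, v, hu, hA, hv, rfl⟩ := h
  -- For `e ≤ d`, the last `e` matrices applied to `v`: a vector of forms of degree `e + 1`, hence
  -- the index shift in `T`. The output sits at level `d + 2`.
  let P : ℕ → Fin m → Poly := fun e => ((List.ofFn A).drop (d - e)).prod.mulVec v
  have hlin : ∀ (a : Fin m → Poly) (Q : Fin m → Poly), (∀ i, (a i).IsHomogeneous 1) →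
      a ⬝ᵥ Q ∈ linForms * Submodule.span ℂ (Set.range Q) := fun a Q ha =>
    Submodule.sum_mem _ fun i _ => Submodule.mul_mem_mul (ha i) (Submodule.subset_span ⟨i, rfl⟩)
  let T : ℕ → Submodule ℂ Poly := fun e =>
    match e with
    | 0 => 1
    | e + 1 => if e ≤ d then Submodule.span ℂ (Set.range (P e)) else
        if e = d + 1 then Submodule.span ℂ {u ⬝ᵥ P d} else ⊥
  refine ⟨T, ⟨le_rfl, ?_⟩, ?_, ?_⟩
  · rintro (_ | e)
    · simp only [T, Nat.zero_le, if_true, mul_one, Submodule.span_le]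
      rintro _ ⟨i, rfl⟩
      have hnil : (List.ofFn A).drop d = [] := List.drop_eq_nil_of_le (by simp)
      simpa [P, hnil] using hv i
    · by_cases h1 : e + 1 ≤ d
      · simp only [T, h1, if_true, show e ≤ d by omega, Submodule.span_le]
        rintro _ ⟨i, rfl⟩
        have hlt : d - (e + 1) < (List.ofFn A).length := by simp; omega
        have : P (e + 1) i = (A ⟨d - (e + 1), by omega⟩ i) ⬝ᵥ P e := by
          simp only [P]
          rw [List.drop_eq_getElem_cons hlt, List.prod_cons, ← Matrix.mulVec_mulVec,
            show d - (e + 1) + 1 = d - e by omega, List.getElem_ofFn]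
          rfl
        rw [SetLike.mem_coe, this]
        exact hlin _ _ (hA _ i)
      · by_cases h2 : e + 1 = d + 1
        · obtain rfl : e = d := by omega
          simp only [T, h1, if_false, if_true, le_refl, Submodule.span_le,
            Set.singleton_subset_iff]
          exact hlin _ _ hu
        · simp only [T, h1, h2, if_false, bot_le]
  · rintro (_ | e)
    · exact spanLE_one.mono (by omega)
    · simp only [T]
      split_ifs
      · exact (spanLE_span_range (P e)).mono (by simp)
      · exact ⟨{u ⬝ᵥ P d}, by simp, by simp⟩
      · exact spanLE_bot _
  · simp [T, P]

theorem derivation_mem_mul (D : Derivation ℂ Poly Poly) {U V : Submodule ℂ Poly} {p : Poly}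
    (hp : p ∈ U * V) :
    D p ∈ U * V.map D.toLinearMap ⊔ U.map D.toLinearMap * V := by
  refine Submodule.mul_induction_on hp ?_ ?_
  · intro u hu v hv
    rw [D.leibniz, smul_eq_mul, smul_eq_mul, mul_comm v]
    exact add_mem (Submodule.mem_sup_left (Submodule.mul_mem_mul hu ⟨v, hv, rfl⟩))
      (Submodule.mem_sup_right (Submodule.mul_mem_mul ⟨u, hu, rfl⟩ hv))
  · intro x y hx hy
    rw [map_add]
    exact add_mem hx hy

/-- For a linear form `l`, `∂(l t) = l ∂t + (∂l) t` with `∂l` a scalar. The second summand has not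
been differentiated and lies in the old space one level up, which is why the old spaces are kept
beside the derivatives. -/
theorem IsChain.pderiv {T : ℕ → Submodule ℂ Poly} (hT : IsChain T) (i : ℕ) :
    IsChain fun e => T e ⊔ (T (e + 1)).map (MvPolynomial.pderiv (R := ℂ) i).toLinearMap := by
  have hlin : linForms.map (MvPolynomial.pderiv (R := ℂ) i).toLinearMap ≤ 1 := by
    rintro _ ⟨l, hl, rfl⟩
    have h0 : (MvPolynomial.pderiv i l).IsHomogeneous 0 := IsHomogeneous.pderiv hl
    rw [← totalDegree_zero_iff_isHomogeneous, totalDegree_eq_zero_iff_eq_C] at h0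
    exact Submodule.mem_one.2 ⟨_, h0.symm⟩
  refine ⟨sup_le hT.zero_le ((Submodule.map_mono hT.one_le).trans hlin), fun e => sup_le ?_ ?_⟩
  · exact (hT.succ_le e).trans (mul_le_mul' le_rfl le_sup_left)
  · rintro _ ⟨p, hp, rfl⟩
    have hsup := derivation_mem_mul (MvPolynomial.pderiv i) (hT.succ_le (e + 1) hp)
    refine (sup_le (mul_le_mul' le_rfl le_sup_right) ?_ : _ ≤ linForms * _) hsup
    refine (mul_le_mul' hlin le_rfl).trans ?_
    rw [one_mul]
    exact (hT.succ_le e).trans (mul_le_mul' le_rfl le_sup_left)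

theorem HomWidthLE.pderiv {m d : ℕ} (hd : 2 ≤ d) {p : Poly} (h : HomWidthLE m d p) (i : ℕ) :
    HomWidthLE (2 * (m + 1)) (d - 1) (MvPolynomial.pderiv i p) := by
  obtain ⟨T, hT, hTm, hp⟩ := h.exists_chain hd
  refine (hT.pderiv i).homWidthLE (by omega) (fun e _ => ?_) (Submodule.mem_sup_right ⟨p, ?_, rfl⟩)
  · exact ((hTm e).sup ((hTm (e + 1)).map _)).mono (by omega)
  · rwa [show d - 1 + 1 = d by omega]

/-! ### Depth reduction for self-generating families of spaces -/

/-- Induction on `h`: the new chain at level `e` collects all `T c * V a` with `c + a = e` and `a <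
2 ^ (h + 1)`. A linear form is split off `T c` when `c > 0`. When `c = 0`, `V a` is first expanded
once and the linear form is split off the factor of smaller degree, to which the previous chain
applies. -/
theorem exists_chain_of_le_sup {V : ℕ → Submodule ℂ Poly} (h0 : V 0 = 1) (h1 : V 1 ≤ linForms)
    (hV : ∀ e, 2 ≤ e → V e ≤ ((Finset.HasAntidiagonal.antidiagonal e).filter fun x => 1 ≤ x.1 ∧ 1 ≤ x.2).sup
      fun x => V x.1 * V x.2) {s D : ℕ} (hs : ∀ e, SpanLE (V e) s) (h : ℕ) :
    ∃ T : ℕ → Submodule ℂ Poly, IsChain T ∧ T 0 = 1 ∧ (∀ b < 2 ^ h, V b ≤ T b) ∧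
      ∀ e ≤ D, SpanLE (T e) (((D + 1) * s) ^ h) := by
  induction h with
  | zero =>
    refine ⟨fun e => if e = 0 then 1 else ⊥, ⟨by simp, by simp⟩, by simp, ?_, ?_⟩
    · intro b hb
      obtain rfl : b = 0 := by simpa using hb
      simp [h0]
    · intro e _
      by_cases he : e = 0
      · simpa [he] using spanLE_one
      · simpa [he] using spanLE_bot 1
  | succ h ih =>
    obtain ⟨T, hT, hT0, hVT, hTs⟩ := ih
    let I : ℕ → Finset (ℕ × ℕ) := fun e =>
      (Finset.HasAntidiagonal.antidiagonal e).filter fun x => x.2 < 2 ^ (h + 1)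
    let T' : ℕ → Submodule ℂ Poly := fun e => (I e).sup fun x => T x.1 * V x.2
    have hle : ∀ c a, a < 2 ^ (h + 1) → T c * V a ≤ T' (c + a) := fun c a ha =>
      Finset.le_sup (f := fun x : ℕ × ℕ => T x.1 * V x.2) (b := (c, a)) (by simp [I, ha])
    have hT'0 : T' 0 = 1 := by simp [T', I, Finset.filter_singleton, hT0, h0]
    refine ⟨T', ⟨hT'0.le, ?_⟩, hT'0, ?_, ?_⟩
    · intro e
      refine Finset.sup_le ?_
      rintro ⟨c, a⟩ hca
      obtain ⟨hca, ha⟩ : c + a = e + 1 ∧ a < 2 ^ (h + 1) := by simpa [I] using hca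
      simp only
      rcases c with _ | c
      · rw [hT0, one_mul]
        obtain rfl : a = e + 1 := by omega
        rcases e with _ | e
        · rw [hT'0, mul_one]; exact h1
        · refine (hV _ (by omega)).trans (Finset.sup_le ?_)
          -- The smaller degree `b` is at most half of `e + 2 < 2 ^ (h + 1)`, so `V b` lies in the
          -- old chain; the other factor stays as the `V` part of the new one.
          have key : ∀ b a, b + a = e + 2 → 1 ≤ b → b ≤ a → V b * V a ≤ linForms * T' (e + 1) := by
            intro b a hba hb hle'
            obtain ⟨b, rfl⟩ := Nat.exists_eq_add_of_le' hb
            have hlt : b + 1 < 2 ^ h := by rw [pow_succ] at ha; omega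
            calc V (b + 1) * V a ≤ (linForms * T b) * V a :=
                  mul_le_mul' ((hVT _ hlt).trans (hT.succ_le b)) le_rfl
              _ = linForms * (T b * V a) := mul_assoc _ _ _
              _ ≤ linForms * T' (e + 1) := by
                  refine mul_le_mul' le_rfl ?_
                  rw [show e + 1 = b + a by omega]
                  exact hle b a (by omega)
          rintro ⟨b, a⟩ hba
          obtain ⟨hba, hb, ha'⟩ : b + a = e + 2 ∧ 1 ≤ b ∧ 1 ≤ a := by simpa using hba
          rcases le_total b a with hle' | hle'
          · exact key b a hba hb hle'
          · simp only
            rw [mul_comm (V b)]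
            exact key a b (by omega) ha' hle'
      · calc T (c + 1) * V a ≤ (linForms * T c) * V a := mul_le_mul' (hT.succ_le c) le_rfl
          _ = linForms * (T c * V a) := mul_assoc _ _ _
          _ ≤ linForms * T' e := by
              refine mul_le_mul' le_rfl ?_
              rw [show e = c + a by omega]
              exact hle c a ha
    · intro b hb
      have := hle 0 b hb
      rwa [hT0, one_mul, zero_add] at this
    · intro e he
      refine (spanLE_finset_sup (I e) _ (((D + 1) * s) ^ h * s) ?_).mono ?_
      · rintro ⟨c, a⟩ hca
        obtain ⟨hca, -⟩ : c + a = e ∧ a < 2 ^ (h + 1) := by simpa [I] using hca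
        exact (hTs c (by omega)).mul (hs a)
      · have hI : (I e).card ≤ D + 1 :=
          (Finset.card_filter_le _ _).trans (by rw [Finset.Nat.card_antidiagonal]; omega)
        calc (I e).card * (((D + 1) * s) ^ h * s) ≤ (D + 1) * (((D + 1) * s) ^ h * s) :=
              Nat.mul_le_mul_right _ hI
          _ = ((D + 1) * s) ^ (h + 1) := by ring

/-! ### Straight-line programs -/

/-- Lists of polynomials, newest first, in which every entry arises by one `step` from the
entries below it. -/
inductive StraightLine (step : Set Poly → Poly → Prop) : List Poly → Prop
  | nil : StraightLine step []
  | cons {l : List Poly} {p : Poly} :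
      StraightLine step l → step {q | q ∈ l} p → StraightLine step (p :: l)

theorem StraightLine.append {step : Set Poly → Poly → Prop}
    (hstep : ∀ ⦃S T : Set Poly⦄, S ⊆ T → ∀ p, step S p → step T p) {l l' : List Poly}
    (h : StraightLine step l) (h' : StraightLine step l') : StraightLine step (l ++ l') := by
  induction h with
  | nil => exact h'
  | cons _ hp ih => exact ih.cons (hstep (fun q hq => List.mem_append_left _ hq) _ hp)

/-- Counting from the oldest entry gives the topological numbering of circuits; a new head receives
the index `l.length`. -/
theorem StraightLine.exists_seq {step : Set Poly → Poly → Prop} {l : List Poly}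
    (h : StraightLine step l) :
    ∃ g : ℕ → Poly, (∀ i < l.length, step {q | ∃ j < i, g j = q} (g i)) ∧
      ∀ p, p ∈ l ↔ ∃ i < l.length, g i = p := by
  induction h with
  | nil => exact ⟨0, by simp, by simp⟩
  | @cons l p hl hp ih =>
    obtain ⟨g, hg, hgl⟩ := ih
    have hset : ∀ i ≤ l.length,
        {q | ∃ j < i, Function.update g l.length p j = q} = {q | ∃ j < i, g j = q} := by
      intro i hi
      ext q
      refine exists_congr fun j => and_congr_right fun hj => ?_
      rw [Function.update_of_ne (by omega)]
    refine ⟨Function.update g l.length p, fun i hi => ?_, fun q => ?_⟩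
    · rw [List.length_cons] at hi
      rw [hset i (by omega)]
      rcases Nat.lt_succ_iff_lt_or_eq.1 hi with hi | rfl
      · rw [Function.update_of_ne (by omega)]
        exact hg i hi
      · rw [Function.update_self]
        have : {q | q ∈ l} = {q | ∃ j < l.length, g j = q} := Set.ext fun q => hgl q
        rwa [← this]
    · rw [List.mem_cons, hgl q, List.length_cons]
      constructor
      · rintro (rfl | ⟨i, hi, rfl⟩)
        · exact ⟨l.length, by omega, by simp⟩
        · exact ⟨i, by omega, by rw [Function.update_of_ne (by omega)]⟩
      · rintro ⟨i, hi, rfl⟩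
        rcases Nat.lt_succ_iff_lt_or_eq.1 hi with hi | rfl
        · rw [Function.update_of_ne (by omega)]
          exact Or.inr ⟨i, hi, rfl⟩
        · simp

theorem StraightLine.of_fin {step : Set Poly → Poly → Prop}
    (hstep : ∀ ⦃S T : Set Poly⦄, S ⊆ T → ∀ p, step S p → step T p) {s : ℕ} (g : Fin s → Poly)
    (hg : ∀ i, step {q | ∃ j < i, g j = q} (g i)) :
    ∃ l : List Poly, l.length = s ∧ StraightLine step l ∧ ∀ p, (∃ i, g i = p) → p ∈ l := by
  induction s with
  | zero => exact ⟨[], rfl, .nil, fun p ⟨i, _⟩ => i.elim0⟩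
  | succ s ih =>
    obtain ⟨l, hl, hsl, hmem⟩ := ih (fun i => g i.castSucc) fun i => by
      refine hstep ?_ _ (hg i.castSucc)
      rintro q ⟨j, hj, rfl⟩
      exact ⟨⟨j, by have := i.isLt; simp only [Fin.lt_def, Fin.val_castSucc] at hj; omega⟩, hj, rfl⟩
    refine ⟨g (Fin.last s) :: l, by simp [hl], hsl.cons (hstep ?_ _ (hg _)), ?_⟩
    · rintro q ⟨j, hj, rfl⟩
      exact hmem _ ⟨⟨j, hj⟩, rfl⟩
    · rintro p ⟨i, rfl⟩
      refine Fin.lastCases ?_ (fun j => ?_) i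
      · simp
      · exact List.mem_cons_of_mem _ (hmem _ ⟨j, rfl⟩)

/-- `p` can be computed by one gate of an arithmetic circuit from `S`. -/
def BinaryStep (S : Set Poly) (p : Poly) : Prop :=
  p.totalDegree ≤ 1 ∨ (∃ q ∈ S, ∃ r ∈ S, q + r = p) ∨ ∃ q ∈ S, ∃ r ∈ S, q * r = p

/-- `p` can be computed by one gate of an IHL circuit over the arity 3 basis from `S`. -/
def TernaryStep (S : Set Poly) (p : Poly) : Prop :=
  p.IsHomogeneous 1 ∨ (∃ a : ℂ, ∃ q ∈ S, ∃ b : ℂ, ∃ r ∈ S, a • q + b • r = p) ∨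
    ∃ a : ℂ, ∃ q ∈ S, ∃ b : ℂ, ∃ r ∈ S, ∃ c : ℂ, ∃ t ∈ S, (a • q) * (b • r) * (c • t) = p

theorem BinaryStep.mono ⦃S T : Set Poly⦄ (h : S ⊆ T) (p : Poly) (hp : BinaryStep S p) :
    BinaryStep T p := by
  rcases hp with hp | ⟨q, hq, r, hr, rfl⟩ | ⟨q, hq, r, hr, rfl⟩
  · exact Or.inl hp
  · exact Or.inr (Or.inl ⟨q, h hq, r, h hr, rfl⟩)
  · exact Or.inr (Or.inr ⟨q, h hq, r, h hr, rfl⟩)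

theorem TernaryStep.mono ⦃S T : Set Poly⦄ (h : S ⊆ T) (p : Poly) (hp : TernaryStep S p) :
    TernaryStep T p := by
  rcases hp with hp | ⟨a, q, hq, b, r, hr, rfl⟩ | ⟨a, q, hq, b, r, hr, c, t, ht, rfl⟩
  · exact Or.inl hp
  · exact Or.inr (Or.inl ⟨a, q, h hq, b, r, h hr, rfl⟩)
  · exact Or.inr (Or.inr ⟨a, q, h hq, b, r, h hr, c, t, h ht, rfl⟩)

theorem Circuit.exists_straightLine {s : ℕ} (C : Circuit s) :
    ∃ l : List Poly, l.length = s ∧ StraightLine BinaryStep l ∧ ∀ p, C.Computes p → p ∈ l := by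
  refine StraightLine.of_fin BinaryStep.mono C.val fun i => ?_
  rw [Circuit.val]
  cases C.gate i with
  | leaf l hl => exact Or.inl hl
  | add j k => exact Or.inr (Or.inl ⟨_, ⟨_, j.isLt, rfl⟩, _, ⟨_, k.isLt, rfl⟩, rfl⟩)
  | mul j k => exact Or.inr (Or.inr ⟨_, ⟨_, j.isLt, rfl⟩, _, ⟨_, k.isLt, rfl⟩, rfl⟩)

theorem Circuit3.exists_straightLine {s : ℕ} (C : Circuit3 s) :
    ∃ l : List Poly, l.length = s ∧ StraightLine TernaryStep l ∧ ∀ p, C.Computes p → p ∈ l := by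
  refine StraightLine.of_fin TernaryStep.mono C.val fun i => ?_
  rw [Circuit3.val]
  cases C.gate i with
  | leaf l hl => exact Or.inl hl
  | add a j b k => exact Or.inr (Or.inl ⟨a, _, ⟨_, j.isLt, rfl⟩, b, _, ⟨_, k.isLt, rfl⟩, rfl⟩)
  | mul a j b k c l =>
    exact Or.inr (Or.inr ⟨a, _, ⟨_, j.isLt, rfl⟩, b, _, ⟨_, k.isLt, rfl⟩, c, _,
      ⟨_, l.isLt, rfl⟩, rfl⟩)

theorem StraightLine.exists_circuit {l : List Poly} (h : StraightLine BinaryStep l) :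
    ∃ C : Circuit l.length, ∀ p ∈ l, C.Computes p := by
  obtain ⟨g, hg, hgl⟩ := h.exists_seq
  have hgate : ∀ i : Fin l.length, ∃ G : Gate i.val,
      g i = match G with
        | .leaf l _ => l
        | .add j k => g j + g k
        | .mul j k => g j * g k := by
    intro i
    rcases hg i i.isLt with hp | ⟨_, ⟨j, hj, rfl⟩, _, ⟨k, hk, rfl⟩, h⟩ |
      ⟨_, ⟨j, hj, rfl⟩, _, ⟨k, hk, rfl⟩, h⟩
    · exact ⟨.leaf _ hp, rfl⟩
    · exact ⟨.add ⟨j, hj⟩ ⟨k, hk⟩, h.symm⟩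
    · exact ⟨.mul ⟨j, hj⟩ ⟨k, hk⟩, h.symm⟩
  choose G hG using hgate
  have hval : ∀ (n : ℕ) (hn : n < l.length), (Circuit.mk G).val ⟨n, hn⟩ = g n := by
    intro n
    induction n using Nat.strong_induction_on with
    | _ n ih =>
      intro hn
      rw [Circuit.val, hG ⟨n, hn⟩]
      cases hGn : G ⟨n, hn⟩ with
      | leaf l hl => simp only [hGn]
      | add j k => simp only [hGn, ih j.val j.isLt, ih k.val k.isLt]
      | mul j k => simp only [hGn, ih j.val j.isLt, ih k.val k.isLt]
  refine ⟨⟨G⟩, fun p hp => ?_⟩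
  obtain ⟨i, hi, rfl⟩ := (hgl p).1 hp
  exact ⟨⟨i, hi⟩, hval i hi⟩

theorem StraightLine.exists_circuit3 {l : List Poly} (h : StraightLine TernaryStep l) :
    ∃ C : Circuit3 l.length, ∀ p ∈ l, C.Computes p := by
  obtain ⟨g, hg, hgl⟩ := h.exists_seq
  have hgate : ∀ i : Fin l.length, ∃ G : Gate3 i.val,
      g i = match G with
        | .leaf l _ => l
        | .add a j b k => a • g j + b • g k
        | .mul a j b k c t => (a • g j) * (b • g k) * (c • g t) := by
    intro i
    rcases hg i i.isLt with hp | ⟨a, _, ⟨j, hj, rfl⟩, b, _, ⟨k, hk, rfl⟩, h⟩ |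
      ⟨a, _, ⟨j, hj, rfl⟩, b, _, ⟨k, hk, rfl⟩, c, _, ⟨t, ht, rfl⟩, h⟩
    · exact ⟨.leaf _ hp, rfl⟩
    · exact ⟨.add a ⟨j, hj⟩ b ⟨k, hk⟩, h.symm⟩
    · exact ⟨.mul a ⟨j, hj⟩ b ⟨k, hk⟩ c ⟨t, ht⟩, h.symm⟩
  choose G hG using hgate
  have hval : ∀ (n : ℕ) (hn : n < l.length), (Circuit3.mk G).val ⟨n, hn⟩ = g n := by
    intro n
    induction n using Nat.strong_induction_on with
    | _ n ih =>
      intro hn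
      rw [Circuit3.val, hG ⟨n, hn⟩]
      cases hGn : G ⟨n, hn⟩ with
      | leaf l hl => simp only [hGn]
      | add a j b k => simp only [hGn, ih j.val j.isLt, ih k.val k.isLt]
      | mul a j b k c t => simp only [hGn, ih j.val j.isLt, ih k.val k.isLt, ih t.val t.isLt]
  refine ⟨⟨G⟩, fun p hp => ?_⟩
  obtain ⟨i, hi, rfl⟩ := (hgl p).1 hp
  exact ⟨⟨i, hi⟩, hval i hi⟩

/-! ### From circuits to homogeneous branching programs -/

/-- Both sides are bilinear, so two monomials suffice; then only the pair of their degrees can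
contribute. -/
theorem homogeneousComponent_mul (e : ℕ) (p q : Poly) :
    homogeneousComponent e (p * q) = ∑ x ∈ Finset.HasAntidiagonal.antidiagonal e,
      homogeneousComponent x.1 p * homogeneousComponent x.2 q := by
  induction p using MvPolynomial.induction_on' with
  | add p p' hp hp' => simp only [add_mul, map_add, hp, hp', Finset.sum_add_distrib]
  | monomial m a =>
    induction q using MvPolynomial.induction_on' with
    | add q q' hq hq' => simp only [mul_add, map_add, hq, hq', Finset.sum_add_distrib]
    | monomial n b =>
      have hm : ∀ (k : ℕ) (u : ℕ →₀ ℕ) (c : ℂ), homogeneousComponent k (monomial u c) =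
          if k = u.degree then monomial u c else 0 := fun k u c =>
        homogeneousComponent_of_mem (isHomogeneous_monomial c rfl)
      simp only [monomial_mul, hm, map_add]
      split_ifs with h
      · rw [Finset.sum_eq_single (m.degree, n.degree)]
        · simp [monomial_mul]
        · rintro ⟨x, y⟩ - hne
          by_cases h1 : x = m.degree
          · by_cases h2 : y = n.degree
            · exact absurd (by rw [h1, h2]) hne
            · simp [h2]
          · simp [h1]
        · intro hne
          exact absurd (by simpa using h.symm) hne
      · refine (Finset.sum_eq_zero ?_).symm
        rintro ⟨x, y⟩ hxy
        have hxy : x + y = e := by simpa using hxy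
        by_cases h1 : x = m.degree
        · by_cases h2 : y = n.degree
          · omega
          · simp [h2]
        · simp [h1]

/-- The space spanned by the degree `e` components of the members of `l`, and the scalars if
`e = 0`. -/
noncomputable def componentSpace (l : List Poly) (e : ℕ) : Submodule ℂ Poly :=
  if e = 0 then 1 else Submodule.span ℂ {q | ∃ p ∈ l, homogeneousComponent e p = q}

theorem homogeneousComponent_mem_componentSpace {l : List Poly} {p : Poly} (hp : p ∈ l) (e : ℕ) :
    homogeneousComponent e p ∈ componentSpace l e := by
  unfold componentSpace
  split_ifs with h
  · subst h
    rw [homogeneousComponent_zero]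
    exact Submodule.mem_one.2 ⟨_, rfl⟩
  · exact Submodule.subset_span ⟨p, hp, rfl⟩

theorem spanLE_componentSpace (l : List Poly) (e : ℕ) :
    SpanLE (componentSpace l e) (l.length + 1) := by
  classical
  unfold componentSpace
  split_ifs
  · exact spanLE_one.mono (by omega)
  · refine ⟨(l.map (homogeneousComponent e)).toFinset, ?_, ?_⟩
    · exact (List.toFinset_card_le _).trans (by simp)
    · congr 1
      ext q
      simp

/-- Affine leaves have no component of degree `e ≥ 2`, and sums are harmless. In a product, a factor
of degree `0` is a scalar, so that term is a multiple of a component of an earlier entry and falls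
under the induction. The induction runs over programs contained in `l` while the spaces remain those
of `l`. -/
theorem StraightLine.componentSpace_le {l : List Poly} (h : StraightLine BinaryStep l) {e : ℕ}
    (he : 2 ≤ e) :
    componentSpace l e ≤ ((Finset.HasAntidiagonal.antidiagonal e).filter
      fun x => 1 ≤ x.1 ∧ 1 ≤ x.2).sup fun x => componentSpace l x.1 * componentSpace l x.2 := by
  suffices H : ∀ l', StraightLine BinaryStep l' → l' ⊆ l → ∀ p ∈ l',
      homogeneousComponent e p ∈ ((Finset.HasAntidiagonal.antidiagonal e).filter
        fun x => 1 ≤ x.1 ∧ 1 ≤ x.2).sup fun x => componentSpace l x.1 * componentSpace l x.2 by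
    rw [componentSpace, if_neg (by omega), Submodule.span_le]
    rintro _ ⟨p, hp, rfl⟩
    exact H l h (List.Subset.refl l) p hp
  intro l' h'
  induction h' with
  | nil => simp
  | @cons l' p hl' hp ih =>
    intro hsub x hx
    have hsub' : l' ⊆ l := fun y hy => hsub (List.mem_cons_of_mem _ hy)
    rcases List.mem_cons.1 hx with rfl | hx
    · rcases hp with hp | ⟨q, hq, r, hr, rfl⟩ | ⟨q, hq, r, hr, rfl⟩
      · rw [homogeneousComponent_eq_zero _ _ (by omega)]
        exact zero_mem _
      · rw [map_add]
        exact add_mem (ih hsub' q hq) (ih hsub' r hr)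
      · rw [homogeneousComponent_mul]
        refine Submodule.sum_mem _ ?_
        rintro ⟨a, b⟩ hab
        have hab' : a + b = e := by simpa using hab
        by_cases ha : a = 0
        · subst ha
          obtain rfl : b = e := by omega
          rw [homogeneousComponent_zero, ← smul_eq_C_mul]
          exact Submodule.smul_mem _ _ (ih hsub' r hr)
        by_cases hb : b = 0
        · subst hb
          obtain rfl : a = e := by omega
          rw [homogeneousComponent_zero, mul_comm, ← smul_eq_C_mul]
          exact Submodule.smul_mem _ _ (ih hsub' q hq)
        refine Finset.le_sup (f := fun x : ℕ × ℕ => componentSpace l x.1 * componentSpace l x.2)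
          (b := (a, b)) ?_ (Submodule.mul_mem_mul ?_ ?_)
        · rw [Finset.mem_filter]
          exact ⟨hab, by omega, by omega⟩
        · exact homogeneousComponent_mem_componentSpace (hsub' hq) a
        · exact homogeneousComponent_mem_componentSpace (hsub' hr) b
    · exact ih hsub' x hx

theorem CircuitSizeLE.bpWidthLE {p : Poly} {s : ℕ} (h : CircuitSizeLE p s) :
    BPWidthLE p ((p.totalDegree + 1) *
      ((p.totalDegree + 1) * (s + 1)) ^ (Nat.log 2 p.totalDegree + 1)) := by
  obtain ⟨r, hr, C, hC⟩ := h
  obtain ⟨l, hlen, hl, hmem⟩ := C.exists_straightLine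
  have hp := hmem p hC
  obtain ⟨T, hT, -, hVT, hTs⟩ := exists_chain_of_le_sup (V := componentSpace l)
    (by simp [componentSpace])
    (by
      rw [componentSpace, if_neg one_ne_zero, Submodule.span_le]
      rintro _ ⟨p, -, rfl⟩
      exact homogeneousComponent_isHomogeneous 1 p)
    (fun e he => hl.componentSpace_le he) (s := s + 1) (D := p.totalDegree)
    (fun e => (spanLE_componentSpace l e).mono (by omega)) (Nat.log 2 p.totalDegree + 1)
  refine ⟨fun _ => ((p.totalDegree + 1) * (s + 1)) ^ (Nat.log 2 p.totalDegree + 1),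
    fun d hd => ?_, ?_⟩
  · rw [Finset.mem_range] at hd
    refine hT.homWidthLE (Nat.one_le_pow _ _ (by positivity)) (fun e he => hTs e (by omega)) ?_
    refine hVT d ?_ (homogeneousComponent_mem_componentSpace hp d)
    exact (Nat.lt_succ_iff.1 hd).trans_lt (Nat.lt_pow_succ_log_self (by norm_num) _)
  · rw [Finset.sum_const, Finset.card_range, smul_eq_mul]

/-! ### From branching programs to formulas over the arity 3 basis -/

/-- `p` has an IHL formula over the arity 3 basis of size at most `s`. -/
def TernarySizeLE (p : Poly) (s : ℕ) : Prop :=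
  ∃ F : Formula3, F.eval = p ∧ F.size ≤ s

theorem TernarySizeLE.mono {p : Poly} {s t : ℕ} (h : TernarySizeLE p s) (hst : s ≤ t) :
    TernarySizeLE p t := by
  obtain ⟨F, hF, hs⟩ := h
  exact ⟨F, hF, hs.trans hst⟩

theorem ternarySizeLE_of_isHomogeneous {p : Poly} (hp : p.IsHomogeneous 1) :
    TernarySizeLE p 1 := ⟨.leaf p hp, rfl, le_rfl⟩

theorem TernarySizeLE.mul {p q r : Poly} {s t u : ℕ} (hp : TernarySizeLE p s)
    (hq : TernarySizeLE q t) (hr : TernarySizeLE r u) :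
    TernarySizeLE (p * q * r) (s + t + u + 1) := by
  obtain ⟨F, rfl, hF⟩ := hp
  obtain ⟨G, rfl, hG⟩ := hq
  obtain ⟨H, rfl, hH⟩ := hr
  exact ⟨.mul F G H, rfl, by simp only [Formula3.size]; omega⟩

theorem ternarySizeLE_sum {ι : Type*} (I : Finset ι) (p : ι → Poly) (t : ℕ)
    (h : ∀ i ∈ I, TernarySizeLE (p i) t) :
    TernarySizeLE (∑ i ∈ I, p i) (1 + I.card * (t + 1)) := by
  classical
  induction I using Finset.induction_on with
  | empty => simpa using ternarySizeLE_of_isHomogeneous (isHomogeneous_zero ℕ ℂ 1)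
  | insert a I ha ih =>
    obtain ⟨F, hF, hFs⟩ := h a (by simp)
    obtain ⟨G, hG, hGs⟩ := ih fun i hi => h i (by simp [hi])
    refine ⟨.add F G, by rw [Finset.sum_insert ha, Formula3.eval, hF, hG], ?_⟩
    rw [Finset.card_insert_of_notMem ha, Formula3.size]
    linarith

/-- A size bound for formulas computing the entries of a product of at most `3 ^ h` matrices. -/
def productSize (m h : ℕ) : ℕ := (6 * (m + 1) ^ 2) ^ h

theorem one_le_productSize (m h : ℕ) : 1 ≤ productSize m h := Nat.one_le_pow _ _ (by positivity)

theorem productSize_mono {m n : ℕ} (hmn : m ≤ n) (h : ℕ) : productSize m h ≤ productSize n h := by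
  unfold productSize
  gcongr

/-- There are `m * m` summands, each with three factors, one product gate and one addition, after an
initial zero leaf; this explains the factor `6 * (m + 1) ^ 2` per level in `productSize`. -/
theorem triple_sum_size_le (m h : ℕ) :
    1 + m * m * (productSize m h + productSize m h + productSize m h + 1 + 1) ≤
      productSize m (h + 1) := by
  have h1 := one_le_productSize m h
  have h2 : productSize m (h + 1) = productSize m h * (6 * (m + 1) ^ 2) := pow_succ _ _
  rw [h2]
  nlinarith [Nat.zero_le (m * m), Nat.zero_le m, Nat.mul_le_mul_left (m * m) h1,
    Nat.mul_le_mul_left m h1]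

theorem ternarySizeLE_sum_mul {m h : ℕ} {a : Fin m → Poly} {B : Matrix (Fin m) (Fin m) Poly}
    {c : Fin m → Poly} (ha : ∀ i, TernarySizeLE (a i) (productSize m h))
    (hB : ∀ i j, TernarySizeLE (B i j) (productSize m h))
    (hc : ∀ i, TernarySizeLE (c i) (productSize m h)) :
    TernarySizeLE (a ⬝ᵥ B.mulVec c) (productSize m (h + 1)) := by
  have heq : a ⬝ᵥ B.mulVec c = ∑ x : Fin m × Fin m, a x.1 * B x.1 x.2 * c x.2 := by
    rw [Fintype.sum_prod_type]
    simp only [dotProduct, Matrix.mulVec, Finset.mul_sum, mul_assoc]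
  rw [heq]
  refine (ternarySizeLE_sum _ _ _ fun x _ => (ha x.1).mul (hB x.1 x.2) (hc x.2)).mono ?_
  simpa using triple_sum_size_le m h

theorem ternarySizeLE_list_prod {m : ℕ} (h : ℕ) (L : List (Matrix (Fin m) (Fin m) Poly))
    (hL : ∀ A ∈ L, ∀ i j, (A i j).IsHomogeneous 1) (hodd : L.length % 2 = 1)
    (hlen : L.length ≤ 3 ^ h) (i j : Fin m) :
    TernarySizeLE (L.prod i j) (productSize m h) := by
  induction h generalizing L i j with
  | zero =>
    obtain ⟨A, rfl⟩ := List.length_eq_one_iff.1 (by rw [pow_zero] at hlen; omega : L.length = 1)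
    rw [List.prod_singleton]
    exact (ternarySizeLE_of_isHomogeneous (hL A (by simp) i j)).mono (one_le_productSize m 0)
  | succ h ih =>
    have hpow : 3 ^ h % 2 = 1 := by rw [Nat.pow_mod]; simp
    rw [pow_succ] at hlen
    by_cases h1 : L.length = 1
    · obtain ⟨A, rfl⟩ := List.length_eq_one_iff.1 h1
      rw [List.prod_singleton]
      exact (ternarySizeLE_of_isHomogeneous (hL A (by simp) i j)).mono (one_le_productSize m _)
    -- Three odd block lengths `a`, `b` and the rest, each at most `3 ^ h`; the rest is odd because
    -- the total is.
    obtain ⟨a, b, ha, hb, ha1, hb1, hab, hc⟩ : ∃ a b : ℕ, a % 2 = 1 ∧ b % 2 = 1 ∧ a ≤ 3 ^ h ∧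
        b ≤ 3 ^ h ∧ a + b < L.length ∧ L.length ≤ a + b + 3 ^ h := by
      generalize 3 ^ h = t at *
      by_cases hs : L.length ≤ t + 1
      · exact ⟨1, 1, rfl, rfl, by omega, by omega, by omega, by omega⟩
      · by_cases hs' : L.length ≤ 2 * t + 1
        · exact ⟨L.length - t - 1, 1, by omega, rfl, by omega, by omega, by omega, by omega⟩
        · exact ⟨t, L.length - 2 * t, by omega, by omega, by omega, by omega, by omega, by omega⟩
    have hsplit : L.prod = (L.take a).prod * (((L.drop a).take b).prod *
        ((L.drop a).drop b).prod) := by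
      rw [List.prod_take_mul_prod_drop, List.prod_take_mul_prod_drop]
    have hentry : L.prod i j = (L.take a).prod i ⬝ᵥ
        ((L.drop a).take b).prod.mulVec fun k => ((L.drop a).drop b).prod k j := by
      rw [hsplit]
      rfl
    rw [hentry]
    refine ternarySizeLE_sum_mul (fun k => ?_) (fun k l => ?_) (fun k => ?_)
    · exact ih _ (fun A hA => hL A (List.mem_of_mem_take hA)) (by simp; omega) (by simp; omega) _ _
    · exact ih _ (fun A hA => hL A (List.mem_of_mem_drop (List.mem_of_mem_take hA)))
        (by simp; omega) (by simp; omega) _ _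
    · exact ih _ (fun A hA => hL A (List.mem_of_mem_drop (List.mem_of_mem_drop hA)))
        (by simp; omega) (by simp; omega) _ _

/-- The end vectors serve as first and third factor of one final ternary product whose middle is the
product of the `d - 2` inner matrices; this is the extra level in `h + 1`. -/
theorem HomWidthLE.ternarySizeLE {m d h : ℕ} {p : Poly} (hp : HomWidthLE m d p)
    (hodd : d % 2 = 1) (hd : d ≤ 3 ^ h) : TernarySizeLE p (productSize m (h + 1)) := by
  match d, hp with
  | 1, hp => exact (ternarySizeLE_of_isHomogeneous hp.1).mono (one_le_productSize m _)
  | d + 2, ⟨u, A, v, hu, hA, hv, hp⟩ =>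
    rw [hp]
    refine ternarySizeLE_sum_mul
      (fun i => (ternarySizeLE_of_isHomogeneous (hu i)).mono (one_le_productSize m _))
      (fun i j => ternarySizeLE_list_prod h _ ?_ (by simp; omega) (by simp; omega) i j)
      (fun i => (ternarySizeLE_of_isHomogeneous (hv i)).mono (one_le_productSize m _))
    intro B hB
    obtain ⟨k, rfl⟩ := (List.mem_ofFn' _ _).1 hB
    exact hA k

theorem card_oddDegrees_le (f : Poly) : (oddDegrees f).card ≤ f.totalDegree + 1 :=
  (Finset.card_filter_le _ _).trans (by simp)

theorem card_evenDegrees_le (f : Poly) : (evenDegrees f).card ≤ f.totalDegree + 1 :=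
  (Finset.card_filter_le _ _).trans (by simp)

theorem BPWidthLE.gradedFormulaSizeLE {p : Poly} {s : ℕ} (h : BPWidthLE p s) :
    GradedFormulaSizeLE p (5 * ((p.totalDegree + 1) * (p.vars.card + 1)) *
      productSize (2 * (s + 1)) (Nat.log 2 p.totalDegree + 2)) := by
  obtain ⟨w, hw, hws⟩ := h
  set h := Nat.log 2 p.totalDegree + 1 with hh
  -- The width `2 * (s + 1)` is what differentiation costs; it also covers the undifferentiated odd
  -- components.
  set B := productSize (2 * (s + 1)) (h + 1) with hB
  have hws' : ∀ d ∈ Finset.range (p.totalDegree + 1), w d ≤ s := fun d hd =>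
    (Finset.single_le_sum (f := w) (fun _ _ => Nat.zero_le _) hd).trans hws
  have hdeg : ∀ d ∈ Finset.range (p.totalDegree + 1), d ≤ 3 ^ h := fun d hd =>
    calc d ≤ p.totalDegree := Nat.lt_succ_iff.1 (Finset.mem_range.1 hd)
      _ ≤ 2 ^ h := (Nat.lt_pow_succ_log_self (by norm_num) _).le
      _ ≤ 3 ^ h := Nat.pow_le_pow_left (by norm_num) h
  have hodd : ∀ d ∈ oddDegrees p, TernarySizeLE (homogeneousComponent d p) B := by
    intro d hd
    obtain ⟨hd, hd2⟩ := Finset.mem_filter.1 hd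
    exact ((hw d hd).ternarySizeLE hd2 (hdeg d hd)).mono
      (productSize_mono (by have := hws' d hd; omega) _)
  have heven : ∀ d ∈ evenDegrees p, ∀ i,
      TernarySizeLE (pderiv i (homogeneousComponent d p)) B := by
    intro d hd i
    obtain ⟨hd, hd2, hd3⟩ := Finset.mem_filter.1 hd
    refine (((hw d hd).pderiv hd3 i).ternarySizeLE (by omega) (h := h)
      (by have := hdeg d hd; omega)).mono
      (productSize_mono (by have := hws' d hd; omega) _)
  have hF : ∀ d, ∃ F : Formula3, d ∈ oddDegrees p → F.eval = homogeneousComponent d p ∧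
      F.size ≤ B := by
    intro d
    by_cases hd : d ∈ oddDegrees p
    · exact (hodd d hd).imp fun F hF _ => hF
    · exact ⟨.leaf 0 (isHomogeneous_zero ℕ ℂ 1), fun h => absurd h hd⟩
  have hG : ∀ d i, ∃ G : Formula3, d ∈ evenDegrees p →
      G.eval = pderiv i (homogeneousComponent d p) ∧ G.size ≤ B := by
    intro d i
    by_cases hd : d ∈ evenDegrees p
    · exact (heven d hd i).imp fun G hG _ => hG
    · exact ⟨.leaf 0 (isHomogeneous_zero ℕ ℂ 1), fun h => absurd h hd⟩
  choose F hF using hF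
  choose G hG using hG
  refine ⟨F, G, fun d hd => (hF d hd).1, fun d hd i _ => (hG d i hd).1, ?_⟩
  have h1 : ∑ d ∈ oddDegrees p, (F d).size ≤ (oddDegrees p).card * B :=
    Finset.sum_le_card_nsmul _ _ _ fun d hd => (hF d hd).2
  have h2 : ∑ d ∈ evenDegrees p, ∑ i ∈ p.vars, (G d i).size ≤
      (evenDegrees p).card * (p.vars.card * B) :=
    Finset.sum_le_card_nsmul _ _ _ fun d hd =>
      Finset.sum_le_card_nsmul _ _ _ fun i _ => (hG d i hd).2
  have h3 : (oddDegrees p).card * B ≤ (p.totalDegree + 1) * B :=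
    Nat.mul_le_mul_right _ (card_oddDegrees_le p)
  have h4 : (evenDegrees p).card * (p.vars.card * B) ≤ (p.totalDegree + 1) * (p.vars.card * B) :=
    Nat.mul_le_mul_right _ (card_evenDegrees_le p)
  have h5 : (evenDegrees p).card * p.vars.card ≤ (p.totalDegree + 1) * p.vars.card :=
    Nat.mul_le_mul_right _ (card_evenDegrees_le p)
  have h6 := card_oddDegrees_le p
  have hB1 : 1 ≤ B := one_le_productSize _ _
  have h7 : (p.totalDegree + 1) * (p.vars.card + 1) ≤
      (p.totalDegree + 1) * (p.vars.card + 1) * B := Nat.le_mul_of_pos_right _ hB1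
  unfold topSize
  nlinarith [Nat.zero_le ((p.totalDegree + 1) * B), Nat.zero_le (p.totalDegree * B)]

/-! ### From formulas to straight-line programs -/

theorem exists_straightLine_of_finset {step : Set Poly → Poly → Prop}
    (hstep : ∀ ⦃S T : Set Poly⦄, S ⊆ T → ∀ p, step S p → step T p) {ι : Type*} (I : Finset ι)
    (p : ι → Poly) (s : ι → ℕ)
    (h : ∀ i ∈ I, ∃ l, StraightLine step l ∧ p i ∈ l ∧ l.length ≤ s i) :
    ∃ l, StraightLine step l ∧ (∀ i ∈ I, p i ∈ l) ∧ l.length ≤ ∑ i ∈ I, s i := by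
  classical
  induction I using Finset.induction_on with
  | empty => exact ⟨[], .nil, by simp, by simp⟩
  | insert a I ha ih =>
    obtain ⟨l, hl, hpl, hls⟩ := h a (by simp)
    obtain ⟨l', hl', hpl', hls'⟩ := ih fun i hi => h i (by simp [hi])
    refine ⟨l ++ l', hl.append hstep hl', ?_, ?_⟩
    · intro i hi
      rcases Finset.mem_insert.1 hi with rfl | hi
      · exact List.mem_append_left _ hpl
      · exact List.mem_append_right _ (hpl' i hi)
    · rw [Finset.sum_insert ha, List.length_append]
      omega

theorem Formula.exists_straightLine (F : Formula) :
    ∃ l, StraightLine BinaryStep l ∧ F.eval ∈ l ∧ l.length ≤ F.size := by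
  induction F with
  | leaf l hl => exact ⟨[l], .cons .nil (Or.inl hl), by simp [Formula.eval], by simp [Formula.size]⟩
  | add F G hF hG =>
    obtain ⟨l, hl, hFl, hls⟩ := hF
    obtain ⟨l', hl', hGl, hls'⟩ := hG
    refine ⟨(F.eval + G.eval) :: (l ++ l'), (hl.append BinaryStep.mono hl').cons
      (Or.inr (Or.inl ⟨_, List.mem_append_left _ hFl, _, List.mem_append_right _ hGl, rfl⟩)),
      List.mem_cons_self, ?_⟩
    simp only [List.length_cons, List.length_append, Formula.size]
    omega
  | mul F G hF hG =>
    obtain ⟨l, hl, hFl, hls⟩ := hF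
    obtain ⟨l', hl', hGl, hls'⟩ := hG
    refine ⟨(F.eval * G.eval) :: (l ++ l'), (hl.append BinaryStep.mono hl').cons
      (Or.inr (Or.inr ⟨_, List.mem_append_left _ hFl, _, List.mem_append_right _ hGl, rfl⟩)),
      List.mem_cons_self, ?_⟩
    simp only [List.length_cons, List.length_append, Formula.size]
    omega

theorem Formula3.exists_straightLine (F : Formula3) :
    ∃ l, StraightLine TernaryStep l ∧ F.eval ∈ l ∧ l.length ≤ F.size := by
  induction F with
  | leaf l hl =>
    exact ⟨[l], .cons .nil (Or.inl hl), by simp [Formula3.eval], by simp [Formula3.size]⟩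
  | add F G hF hG =>
    obtain ⟨l, hl, hFl, hls⟩ := hF
    obtain ⟨l', hl', hGl, hls'⟩ := hG
    refine ⟨(F.eval + G.eval) :: (l ++ l'), (hl.append TernaryStep.mono hl').cons
      (Or.inr (Or.inl ⟨1, _, List.mem_append_left _ hFl, 1, _, List.mem_append_right _ hGl, ?_⟩)),
      List.mem_cons_self, ?_⟩
    · simp
    · simp only [List.length_cons, List.length_append, Formula3.size]
      omega
  | mul F G H hF hG hH =>
    obtain ⟨l, hl, hFl, hls⟩ := hF
    obtain ⟨l', hl', hGl, hls'⟩ := hG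
    obtain ⟨l'', hl'', hHl, hls''⟩ := hH
    refine ⟨(F.eval * G.eval * H.eval) :: (l ++ (l' ++ l'')),
      (hl.append TernaryStep.mono (hl'.append TernaryStep.mono hl'')).cons
      (Or.inr (Or.inr ⟨1, _, List.mem_append_left _ hFl, 1, _,
        List.mem_append_right _ (List.mem_append_left _ hGl), 1, _,
        List.mem_append_right _ (List.mem_append_right _ hHl), ?_⟩)),
      List.mem_cons_self, ?_⟩
    · simp
    · simp only [List.length_cons, List.length_append, Formula3.size]
      omega

theorem FormulaSizeLE.circuitSizeLE {p : Poly} {s : ℕ} (h : FormulaSizeLE p s) :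
    CircuitSizeLE p s := by
  obtain ⟨F, rfl, hs⟩ := h
  obtain ⟨l, hl, hFl, hls⟩ := F.exists_straightLine
  obtain ⟨C, hC⟩ := hl.exists_circuit
  exact ⟨l.length, hls.trans hs, C, hC _ hFl⟩

theorem GradedFormulaSizeLE.gradedCircuitSizeLE {p : Poly} {s : ℕ} (h : GradedFormulaSizeLE p s) :
    GradedCircuitSizeLE p s := by
  obtain ⟨F, G, hF, hG, hs⟩ := h
  obtain ⟨l, hl, hFl, hls⟩ := exists_straightLine_of_finset TernaryStep.mono (oddDegrees p)
    (fun d => (F d).eval) (fun d => (F d).size) fun d _ => (F d).exists_straightLine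
  obtain ⟨l', hl', hGl, hls'⟩ := exists_straightLine_of_finset TernaryStep.mono
    (evenDegrees p ×ˢ p.vars) (fun x => (G x.1 x.2).eval) (fun x => (G x.1 x.2).size)
    fun x _ => (G x.1 x.2).exists_straightLine
  rw [Finset.sum_product] at hls'
  obtain ⟨C, hC⟩ := (hl.append TernaryStep.mono hl').exists_circuit3
  refine ⟨_, C, fun d hd => ?_, fun d hd i hi => ?_, ?_⟩
  · rw [← hF d hd]
    exact hC _ (List.mem_append_left _ (hFl d hd))
  · rw [← hG d hd i hi]
    exact hC _ (List.mem_append_right _ (hGl (d, i) (Finset.mk_mem_product hd hi)))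
  · rw [List.length_append]
    simp only at hls'
    omega

/-! ### The decomposition by Euler's identity -/

/-- Euler's identity, checked on monomials. A larger index set is allowed because a component may
involve fewer variables than the whole polynomial. -/
theorem sum_X_mul_pderiv_of_vars_subset {p : Poly} {n : ℕ} (hp : p.IsHomogeneous n)
    {S : Finset ℕ} (hS : p.vars ⊆ S) : ∑ i ∈ S, X i * pderiv i p = (n : ℂ) • p := by
  have hmon : ∀ m ∈ p.support, ∑ i ∈ S, X i * pderiv i (monomial m (coeff m p)) =
      (n : ℂ) • monomial m (coeff m p) := by
    intro m hm
    have hdeg : ∑ i ∈ S, m i = n := by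
      rw [hp.degree_eq_sum_deg_support hm]
      refine (Finset.sum_subset (fun i hi => hS ?_) fun i _ hi => ?_).symm
      · exact (mem_vars_iff_mem_support i).2 ⟨m, hm, hi⟩
      · simpa using hi
    simp_rw [X_mul_pderiv_monomial]
    rw [← Finset.sum_smul, hdeg, Nat.cast_smul_eq_nsmul]
  conv_lhs => rw [p.as_sum]
  conv_rhs => rw [p.as_sum]
  simp_rw [map_sum, Finset.mul_sum]
  rw [Finset.sum_comm, Finset.smul_sum]
  exact Finset.sum_congr rfl hmon

theorem vars_homogeneousComponent_subset (d : ℕ) (p : Poly) :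
    (homogeneousComponent d p).vars ⊆ p.vars := by
  intro i hi
  obtain ⟨m, hm, him⟩ := (mem_vars_iff_mem_support i).1 hi
  rw [support_homogeneousComponent] at hm
  exact (mem_vars_iff_mem_support i).2 ⟨m, (Finset.mem_filter.1 hm).1, him⟩

/-- The linear leaf `x_i / d`, as a polynomial. -/
noncomputable def scaledX (d i : ℕ) : Poly := C ((d : ℂ)⁻¹) * X i

theorem totalDegree_scaledX_le (d i : ℕ) : (scaledX d i).totalDegree ≤ 1 :=
  (isHomogeneous_C_mul_X _ i).totalDegree_le

theorem eq_sum_components (f : Poly) :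
    f = C (coeff 0 f) + (∑ d ∈ oddDegrees f, homogeneousComponent d f +
      ∑ x ∈ evenDegrees f ×ˢ f.vars,
        scaledX x.1 x.2 * pderiv x.2 (homogeneousComponent x.1 f)) := by
  have heven : ∑ x ∈ evenDegrees f ×ˢ f.vars,
      scaledX x.1 x.2 * pderiv x.2 (homogeneousComponent x.1 f) =
        ∑ d ∈ evenDegrees f, homogeneousComponent d f := by
    rw [Finset.sum_product]
    refine Finset.sum_congr rfl fun d hd => ?_
    have hd0 : (d : ℂ) ≠ 0 := by
      have := (Finset.mem_filter.1 hd).2.2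
      exact_mod_cast (by omega : d ≠ 0)
    simp only [scaledX, mul_assoc]
    rw [← Finset.mul_sum, sum_X_mul_pderiv_of_vars_subset
      (homogeneousComponent_isHomogeneous d f) (vars_homogeneousComponent_subset d f),
      ← smul_eq_C_mul, inv_smul_smul₀ hd0]
  rw [heven]
  conv_lhs => rw [← sum_homogeneousComponent f]
  rw [Finset.sum_range_succ', homogeneousComponent_zero, add_comm]
  congr 1
  have hdisj : Disjoint (oddDegrees f) (evenDegrees f) := by
    rw [Finset.disjoint_left]
    intro d hd hd'
    have h1 := (Finset.mem_filter.1 hd).2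
    have h2 := (Finset.mem_filter.1 hd').2.1
    omega
  rw [← Finset.sum_union hdisj, Finset.sum_range fun d => homogeneousComponent (d + 1) f,
    ← Finset.sum_range fun d => homogeneousComponent (d + 1) f]
  refine Finset.sum_bij (fun d _ => d + 1) ?_ ?_ ?_ ?_
  · intro d hd
    rw [Finset.mem_range] at hd
    simp only [oddDegrees, evenDegrees, Finset.mem_union, Finset.mem_filter, Finset.mem_range]
    omega
  · intro a _ b _ h
    omega
  · intro d hd
    simp only [oddDegrees, evenDegrees, Finset.mem_union, Finset.mem_filter,
      Finset.mem_range] at hd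
    exact ⟨d - 1, by rw [Finset.mem_range]; omega, by omega⟩
  · intro d _
    rfl

/-! ### From graded formulas to formulas -/

theorem FormulaSizeLE.mono {p : Poly} {s t : ℕ} (h : FormulaSizeLE p s) (hst : s ≤ t) :
    FormulaSizeLE p t := by
  obtain ⟨F, hF, hs⟩ := h
  exact ⟨F, hF, hs.trans hst⟩

theorem formulaSizeLE_of_totalDegree_le {p : Poly} (hp : p.totalDegree ≤ 1) :
    FormulaSizeLE p 1 := ⟨.leaf p hp, rfl, le_rfl⟩

theorem FormulaSizeLE.add {p q : Poly} {s t : ℕ} (hp : FormulaSizeLE p s)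
    (hq : FormulaSizeLE q t) : FormulaSizeLE (p + q) (s + t + 1) := by
  obtain ⟨F, rfl, hF⟩ := hp
  obtain ⟨G, rfl, hG⟩ := hq
  exact ⟨.add F G, rfl, by simp only [Formula.size]; omega⟩

theorem FormulaSizeLE.mul {p q : Poly} {s t : ℕ} (hp : FormulaSizeLE p s)
    (hq : FormulaSizeLE q t) : FormulaSizeLE (p * q) (s + t + 1) := by
  obtain ⟨F, rfl, hF⟩ := hp
  obtain ⟨G, rfl, hG⟩ := hq
  exact ⟨.mul F G, rfl, by simp only [Formula.size]; omega⟩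

theorem formulaSizeLE_sum {ι : Type*} (I : Finset ι) (p : ι → Poly) (s : ι → ℕ)
    (h : ∀ i ∈ I, FormulaSizeLE (p i) (s i)) :
    FormulaSizeLE (∑ i ∈ I, p i) (∑ i ∈ I, s i + I.card + 1) := by
  classical
  induction I using Finset.induction_on with
  | empty => simpa using formulaSizeLE_of_totalDegree_le (by simp : (0 : Poly).totalDegree ≤ 1)
  | insert a I ha ih =>
    rw [Finset.sum_insert ha, Finset.sum_insert ha, Finset.card_insert_of_notMem ha]
    exact ((h a (by simp)).add (ih fun i hi => h i (by simp [hi]))).mono (by omega)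

theorem Formula3.formulaSizeLE (F : Formula3) : FormulaSizeLE F.eval (2 * F.size) := by
  induction F with
  | leaf l hl => exact (formulaSizeLE_of_totalDegree_le hl.totalDegree_le).mono (by simp [size])
  | add F G hF hG => exact (hF.add hG).mono (by simp only [size]; omega)
  | mul F G H hF hG hH => exact ((hF.mul hG).mul hH).mono (by simp only [size]; omega)

theorem GradedFormulaSizeLE.formulaSizeLE {p : Poly} {s : ℕ} (h : GradedFormulaSizeLE p s) :
    FormulaSizeLE p (9 * s) := by
  obtain ⟨F, G, hF, hG, hs⟩ := h
  have hodd := formulaSizeLE_sum (oddDegrees p) (fun d => homogeneousComponent d p)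
    (fun d => 2 * (F d).size) fun d hd => hF d hd ▸ (F d).formulaSizeLE
  have heven := formulaSizeLE_sum (evenDegrees p ×ˢ p.vars)
    (fun x => scaledX x.1 x.2 * pderiv x.2 (homogeneousComponent x.1 p))
    (fun x => 2 * (G x.1 x.2).size + 2) fun x hx => by
      obtain ⟨hx1, hx2⟩ := Finset.mem_product.1 hx
      have hsize := (G x.1 x.2).formulaSizeLE
      rw [hG x.1 hx1 x.2 hx2] at hsize
      exact ((formulaSizeLE_of_totalDegree_le (totalDegree_scaledX_le x.1 x.2)).mul hsize).mono
        (by omega)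
  have hconst : FormulaSizeLE (C (coeff 0 p)) 1 :=
    formulaSizeLE_of_totalDegree_le (by rw [totalDegree_C]; omega)
  rw [eq_sum_components p]
  refine (hconst.add (hodd.add heven)).mono ?_
  rw [Finset.sum_add_distrib, Finset.sum_const, ← Finset.mul_sum, ← Finset.mul_sum,
    Finset.sum_product, Finset.card_product, smul_eq_mul]
  unfold topSize at hs
  simp only at *
  omega

/-! ### From graded circuits to circuits -/

/-- A polynomial computed by a ternary step from members of `l` is computed by at most eight further
binary steps. -/
theorem StraightLine.exists_binary_of_ternaryStep {l : List Poly} (hl : StraightLine BinaryStep l)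
    {S : Set Poly} (hS : ∀ q ∈ S, q ∈ l) {p : Poly} (hp : TernaryStep S p) :
    ∃ l', StraightLine BinaryStep l' ∧ l ⊆ l' ∧ p ∈ l' ∧ l'.length ≤ l.length + 8 := by
  -- An edge scalar costs two entries, a constant leaf and a product. Three of them and two binary
  -- products give the bound eight.
  have hsmul : ∀ {l : List Poly}, StraightLine BinaryStep l → ∀ (a : ℂ) {q : Poly}, q ∈ l →
      ∃ l', StraightLine BinaryStep l' ∧ l ⊆ l' ∧ a • q ∈ l' ∧ l'.length = l.length + 2 := by
    intro l hl a q hq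
    refine ⟨a • q :: C a :: l, (hl.cons (Or.inl (by rw [totalDegree_C]; omega))).cons
      (Or.inr (Or.inr ⟨C a, List.mem_cons_self, q, List.mem_cons_of_mem _ hq, ?_⟩)),
      fun x hx => by simp [hx], List.mem_cons_self, rfl⟩
    rw [smul_eq_C_mul]
  rcases hp with hp | ⟨a, q, hq, b, r, hr, rfl⟩ | ⟨a, q, hq, b, r, hr, c, t, ht, rfl⟩
  · exact ⟨p :: l, hl.cons (Or.inl hp.totalDegree_le), List.subset_cons_self p l,
      List.mem_cons_self, by simp⟩
  · obtain ⟨l₁, hl₁, hs₁, hm₁, hn₁⟩ := hsmul hl a (hS q hq)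
    obtain ⟨l₂, hl₂, hs₂, hm₂, hn₂⟩ := hsmul hl₁ b (hs₁ (hS r hr))
    refine ⟨(a • q + b • r) :: l₂, hl₂.cons (Or.inr (Or.inl ⟨_, hs₂ hm₁, _, hm₂, rfl⟩)),
      fun x hx => List.mem_cons_of_mem _ (hs₂ (hs₁ hx)), List.mem_cons_self, ?_⟩
    rw [List.length_cons]
    omega
  · obtain ⟨l₁, hl₁, hs₁, hm₁, hn₁⟩ := hsmul hl a (hS q hq)
    obtain ⟨l₂, hl₂, hs₂, hm₂, hn₂⟩ := hsmul hl₁ b (hs₁ (hS r hr))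
    obtain ⟨l₃, hl₃, hs₃, hm₃, hn₃⟩ := hsmul hl₂ c (hs₂ (hs₁ (hS t ht)))
    refine ⟨(a • q * b • r * c • t) :: (a • q * b • r) :: l₃,
      (hl₃.cons (Or.inr (Or.inr ⟨_, hs₃ (hs₂ hm₁), _, hs₃ hm₂, rfl⟩))).cons
        (Or.inr (Or.inr ⟨_, List.mem_cons_self, _, List.mem_cons_of_mem _ hm₃, rfl⟩)),
      fun x hx => List.mem_cons_of_mem _ (List.mem_cons_of_mem _ (hs₃ (hs₂ (hs₁ hx)))),
      List.mem_cons_self, ?_⟩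
    simp only [List.length_cons]
    omega

theorem StraightLine.exists_binary_of_ternary {l : List Poly} (h : StraightLine TernaryStep l) :
    ∃ l', StraightLine BinaryStep l' ∧ l ⊆ l' ∧ l'.length ≤ 8 * l.length := by
  induction h with
  | nil => exact ⟨[], .nil, List.Subset.refl _, by simp⟩
  | cons _ hp ih =>
    obtain ⟨l₁, hl₁, hs₁, hn₁⟩ := ih
    obtain ⟨l₂, hl₂, hs₂, hm₂, hn₂⟩ := hl₁.exists_binary_of_ternaryStep (fun q hq => hs₁ hq) hp
    refine ⟨l₂, hl₂, List.cons_subset.2 ⟨hm₂, fun x hx => hs₂ (hs₁ hx)⟩, ?_⟩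
    rw [List.length_cons]
    omega

/-- Each summand costs three entries (coefficient, product, addition), and the sum starts from a
zero leaf. -/
theorem StraightLine.exists_sum {ι : Type*} (I : Finset ι) (p a : ι → Poly)
    (ha : ∀ i ∈ I, (a i).totalDegree ≤ 1) {l : List Poly} (hl : StraightLine BinaryStep l)
    (hp : ∀ i ∈ I, p i ∈ l) :
    ∃ l', StraightLine BinaryStep l' ∧ l ⊆ l' ∧ ∑ i ∈ I, a i * p i ∈ l' ∧
      l'.length ≤ l.length + 3 * I.card + 1 := by
  classical
  induction I using Finset.induction_on with
  | empty =>
    exact ⟨0 :: l, hl.cons (Or.inl (by simp)), List.subset_cons_self _ _, by simp, by simp⟩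
  | insert j I hj ih =>
    obtain ⟨l', hl', hs, hm, hn⟩ := ih (fun i hi => ha i (by simp [hi])) fun i hi =>
      hp i (by simp [hi])
    have h1 := hl'.cons (Or.inl (ha j (by simp)))
    have h2 := h1.cons (Or.inr (Or.inr ⟨a j, List.mem_cons_self, p j,
      List.mem_cons_of_mem _ (hs (hp j (by simp))), rfl⟩))
    have h3 := h2.cons (Or.inr (Or.inl ⟨a j * p j, List.mem_cons_self, _,
      List.mem_cons_of_mem _ (List.mem_cons_of_mem _ hm), rfl⟩))
    refine ⟨_, h3, fun x hx => ?_, ?_, ?_⟩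
    · exact List.mem_cons_of_mem _ (List.mem_cons_of_mem _ (List.mem_cons_of_mem _ (hs hx)))
    · rw [Finset.sum_insert hj]
      exact List.mem_cons_self
    · rw [Finset.card_insert_of_notMem hj]
      simp only [List.length_cons]
      omega

theorem GradedCircuitSizeLE.circuitSizeLE {p : Poly} {s : ℕ} (h : GradedCircuitSizeLE p s) :
    CircuitSizeLE p (9 * s) := by
  obtain ⟨r, K, hodd, heven, hs⟩ := h
  obtain ⟨l₀, hn₀, hl₀, hm₀⟩ := K.exists_straightLine
  obtain ⟨l₁, hl₁, hs₁, hn₁⟩ := hl₀.exists_binary_of_ternary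
  obtain ⟨l₂, hl₂, hs₂, hm₂, hn₂⟩ := hl₁.exists_sum (oddDegrees p)
    (fun d => homogeneousComponent d p) (fun _ => 1) (by simp)
    fun d hd => hs₁ (hm₀ _ (hodd d hd))
  obtain ⟨l₃, hl₃, hs₃, hm₃, hn₃⟩ := hl₂.exists_sum (evenDegrees p ×ˢ p.vars)
    (fun x => pderiv x.2 (homogeneousComponent x.1 p)) (fun x => scaledX x.1 x.2)
    (fun x _ => totalDegree_scaledX_le x.1 x.2) fun x hx => by
      obtain ⟨hx1, hx2⟩ := Finset.mem_product.1 hx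
      exact hs₂ (hs₁ (hm₀ _ (heven x.1 hx1 x.2 hx2)))
  simp only [one_mul] at hm₂
  have h4 := hl₃.cons (Or.inr (Or.inl ⟨_, hs₃ hm₂, _, hm₃, rfl⟩))
  have h5 := h4.cons (Or.inl (by rw [totalDegree_C]; omega : (C (coeff 0 p)).totalDegree ≤ 1))
  have h6 := h5.cons (Or.inr (Or.inl ⟨_, List.mem_cons_self, _,
    List.mem_cons_of_mem _ List.mem_cons_self, rfl⟩))
  rw [← eq_sum_components p] at h6
  obtain ⟨K', hK'⟩ := h6.exists_circuit
  refine ⟨_, ?_, K', hK' p List.mem_cons_self⟩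
  rw [Finset.card_product] at hn₃
  unfold topSize at hs
  simp only [List.length_cons]
  omega

/-! ### Quasipolynomial bounds -/

/-- One `k`, at least the degree and at least the sum of the absolute coefficients, serves as both
factor and exponent. -/
theorem polynomial_eval_le (q : Polynomial ℝ) :
    ∃ k : ℕ, ∀ x : ℝ, 1 ≤ x → q.eval x ≤ k * x ^ k := by
  refine ⟨⌈∑ i ∈ Finset.range (q.natDegree + 1), |q.coeff i|⌉₊ + q.natDegree, fun x hx => ?_⟩
  rw [Polynomial.eval_eq_sum_range]
  set k := ⌈∑ i ∈ Finset.range (q.natDegree + 1), |q.coeff i|⌉₊ + q.natDegree with hk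
  calc ∑ i ∈ Finset.range (q.natDegree + 1), q.coeff i * x ^ i
      ≤ ∑ i ∈ Finset.range (q.natDegree + 1), |q.coeff i| * x ^ k := by
        refine Finset.sum_le_sum fun i hi => ?_
        rw [Finset.mem_range] at hi
        exact mul_le_mul (le_abs_self _) (pow_le_pow_right₀ hx (by omega)) (by positivity)
          (abs_nonneg _)
    _ = (∑ i ∈ Finset.range (q.natDegree + 1), |q.coeff i|) * x ^ k := by rw [Finset.sum_mul]
    _ ≤ k * x ^ k := by
        refine mul_le_mul_of_nonneg_right ((Nat.le_ceil _).trans ?_) (by positivity)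
        exact_mod_cast Nat.le_add_right _ _

theorem PolyBounded.exists_pow {m : ℕ → ℕ} (h : PolyBounded m) :
    ∃ k : ℕ, ∀ n, 2 ≤ n → m n ≤ n ^ k := by
  obtain ⟨t, ht⟩ := h
  obtain ⟨k, hk⟩ := polynomial_eval_le t
  refine ⟨k + k, fun n hn => ?_⟩
  have h1 : (m n : ℝ) ≤ k * (n : ℝ) ^ k :=
    (ht n).trans (hk n (by exact_mod_cast (by omega : 1 ≤ n)))
  have h2 : m n ≤ k * n ^ k := by exact_mod_cast h1
  calc m n ≤ k * n ^ k := h2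
    _ ≤ n ^ k * n ^ k := Nat.mul_le_mul_right _ (Nat.lt_pow_self (by omega)).le
    _ = n ^ (k + k) := (pow_add _ _ _).symm

theorem logb_le_log_add_one {n : ℕ} (hn : 2 ≤ n) :
    Real.logb 2 n ≤ (Nat.log 2 n + 1 : ℕ) := by
  rw [Real.logb_le_iff_le_rpow (by norm_num) (by positivity), Real.rpow_natCast]
  exact_mod_cast (Nat.lt_pow_succ_log_self (by norm_num) n).le

theorem one_le_logb {n : ℕ} (hn : 2 ≤ n) : 1 ≤ Real.logb 2 n := by
  rw [Real.le_logb_iff_rpow_le (by norm_num) (by positivity), Real.rpow_one]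
  exact_mod_cast hn

theorem log_le_logb {n : ℕ} (hn : 2 ≤ n) : (Nat.log 2 n : ℝ) ≤ Real.logb 2 n := by
  rw [Real.le_logb_iff_rpow_le (by norm_num) (by positivity), Real.rpow_natCast]
  exact_mod_cast Nat.pow_log_le_self 2 (by omega)

/-- The integer logarithm is at most `logb` and within one of it, so the real exponent may be traded
for a natural number. -/
theorem quasiPolyBounded_iff (c : ℕ → ℕ) :
    QuasiPolyBounded c ↔ ∃ k : ℕ, ∀ n, 2 ≤ n → c n ≤ n ^ (k * (Nat.log 2 n + 1) ^ k) := by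
  constructor
  · rintro ⟨q, hq⟩
    obtain ⟨k, hk⟩ := polynomial_eval_le q
    refine ⟨k, fun n hn => ?_⟩
    have hn1 : (1 : ℝ) ≤ n := by exact_mod_cast (by omega : 1 ≤ n)
    have h1 : q.eval (Real.logb 2 n) ≤ ((k * (Nat.log 2 n + 1) ^ k : ℕ) : ℝ) := by
      refine (hk _ (one_le_logb hn)).trans ?_
      rw [Nat.cast_mul, Nat.cast_pow]
      have := one_le_logb hn
      gcongr
      exact logb_le_log_add_one hn
    have h2 := (hq n hn).trans (Real.rpow_le_rpow_of_exponent_le hn1 h1)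
    rw [Real.rpow_natCast] at h2
    exact_mod_cast h2
  · rintro ⟨k, hk⟩
    refine ⟨Polynomial.C (k : ℝ) * (Polynomial.X + 1) ^ k, fun n hn => ?_⟩
    have hn1 : (1 : ℝ) ≤ n := by exact_mod_cast (by omega : 1 ≤ n)
    have h1 : ((k * (Nat.log 2 n + 1) ^ k : ℕ) : ℝ) ≤
        (Polynomial.C (k : ℝ) * (Polynomial.X + 1) ^ k).eval (Real.logb 2 n) := by
      simp only [Polynomial.eval_mul, Polynomial.eval_C, Polynomial.eval_pow, Polynomial.eval_add,
        Polynomial.eval_X, Polynomial.eval_one]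
      push_cast
      gcongr
      exact log_le_logb hn
    refine le_trans ?_ (Real.rpow_le_rpow_of_exponent_le hn1 h1)
    rw [Real.rpow_natCast]
    exact_mod_cast hk n hn

/-- As `D` is polynomially bounded, `log D = O(log n)`: the outer power only adds one factor `log n`
to an exponent that is already polylogarithmic. -/
theorem quasiPolyBounded_of_le {c D N c' : ℕ → ℕ} (hc : QuasiPolyBounded c) (hD : PolyBounded D)
    (hN : PolyBounded N) (J : ℕ)
    (h : ∀ n, c' n ≤ (c n + D n + N n + 2) ^ (J * (Nat.log 2 (D n) + 1))) :
    QuasiPolyBounded c' := by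
  rw [quasiPolyBounded_iff] at hc ⊢
  obtain ⟨k, hk⟩ := hc
  obtain ⟨a, ha⟩ := hD.exists_pow
  obtain ⟨b, hb⟩ := hN.exists_pow
  set K := k + a + b + 3 with hK
  -- The first summand is the factor and the second the power of the logarithm in the final
  -- exponent; their sum dominates both.
  refine ⟨K * (J * (a + 1)) + (k + 1), fun n hn => (h n).trans ?_⟩
  set l := Nat.log 2 n + 1 with hl
  have hl1 : 1 ≤ l := by omega
  have hlk : 1 ≤ l ^ k := Nat.one_le_pow _ _ hl1
  set E := (k + a + b) * l ^ k with hE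
  have hcE : c n ≤ n ^ E :=
    (hk n hn).trans (Nat.pow_le_pow_right (by omega) (Nat.mul_le_mul_right _ (by omega)))
  have hDE : D n ≤ n ^ E :=
    (ha n hn).trans (Nat.pow_le_pow_right (by omega) (by nlinarith))
  have hNE : N n ≤ n ^ E :=
    (hb n hn).trans (Nat.pow_le_pow_right (by omega) (by nlinarith))
  have hE1 : 1 ≤ n ^ E := Nat.one_le_pow _ _ (by omega)
  have hbase : c n + D n + N n + 2 ≤ n ^ (K * l ^ k) := by
    calc c n + D n + N n + 2 ≤ n ^ E * 2 ^ 3 := by omega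
      _ ≤ n ^ E * n ^ 3 := Nat.mul_le_mul_left _ (Nat.pow_le_pow_left hn 3)
      _ = n ^ (E + 3) := (pow_add _ _ _).symm
      _ ≤ n ^ (K * l ^ k) := Nat.pow_le_pow_right (by omega) (by rw [hE, hK]; nlinarith)
  have hlog : Nat.log 2 (D n) + 1 ≤ (a + 1) * l := by
    have h1 : D n ≤ 2 ^ (l * a) := by
      rw [pow_mul]
      exact (ha n hn).trans
        (Nat.pow_le_pow_left (Nat.lt_pow_succ_log_self (by norm_num) n).le a)
    have h2 := Nat.log_mono_right (b := 2) h1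
    rw [Nat.log_pow (by norm_num)] at h2
    linarith
  calc (c n + D n + N n + 2) ^ (J * (Nat.log 2 (D n) + 1))
      ≤ (n ^ (K * l ^ k)) ^ (J * (Nat.log 2 (D n) + 1)) := Nat.pow_le_pow_left hbase _
    _ ≤ (n ^ (K * l ^ k)) ^ (J * ((a + 1) * l)) :=
        Nat.pow_le_pow_right (Nat.one_le_pow _ _ (by omega)) (Nat.mul_le_mul_left _ hlog)
    _ = n ^ (K * (J * (a + 1)) * l ^ (k + 1)) := by rw [← pow_mul]; congr 1; ring
    _ ≤ n ^ ((K * (J * (a + 1)) + (k + 1)) * l ^ (K * (J * (a + 1)) + (k + 1))) :=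
        Nat.pow_le_pow_right (by omega)
          (Nat.mul_le_mul (by omega) (Nat.pow_le_pow_right hl1 (by omega)))

theorem quasiPolyClass_subset {L L' : Poly → ℕ → Prop} (J : ℕ)
    (h : ∀ p s, L p s → ∃ t ≤ (s + p.totalDegree + p.vars.card + 2) ^
      (J * (Nat.log 2 p.totalDegree + 1)), L' p t) :
    quasiPolyClass L ⊆ quasiPolyClass L' := by
  rintro f ⟨hf, c, hc, hL⟩
  choose c' hc' hL' using fun n => h (f n) (c n) (hL n)
  exact ⟨hf, c', quasiPolyBounded_of_le hc hf.1 hf.2 J hc', hL'⟩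

theorem nine_mul_le (s D N : ℕ) : 9 * s ≤ (s + D + N + 2) ^ (5 * (Nat.log 2 D + 1)) := by
  calc 9 * s ≤ 2 ^ 4 * (s + D + N + 2) := by omega
    _ ≤ (s + D + N + 2) ^ 4 * (s + D + N + 2) :=
        Nat.mul_le_mul_right _ (Nat.pow_le_pow_left (by omega) 4)
    _ = (s + D + N + 2) ^ 5 := (pow_succ _ _).symm
    _ ≤ _ := Nat.pow_le_pow_right (by omega) (by omega)

theorem VQP_subset_VQBP : VQP ⊆ VQBP := by
  refine quasiPolyClass_subset 3 fun p s h => ⟨_, ?_, h.bpWidthLE⟩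
  set D := p.totalDegree
  set y := s + D + p.vars.card + 2 with hy
  calc (D + 1) * ((D + 1) * (s + 1)) ^ (Nat.log 2 D + 1)
      ≤ y * (y * y) ^ (Nat.log 2 D + 1) := by
        gcongr <;> omega
    _ = y ^ (1 + 2 * (Nat.log 2 D + 1)) := by rw [pow_add y, pow_mul y, pow_one, sq]
    _ ≤ y ^ (3 * (Nat.log 2 D + 1)) := Nat.pow_le_pow_right (by omega) (by omega)

theorem VQBP_subset_VQ3F : VQBP ⊆ VQ3F := by
  refine quasiPolyClass_subset 19 fun p s h => ⟨_, ?_, h.gradedFormulaSizeLE⟩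
  set D := p.totalDegree
  set y := s + D + p.vars.card + 2 with hy
  have hy2 : 2 ≤ y := by omega
  have hy3 : 8 ≤ y ^ 3 := Nat.pow_le_pow_left hy2 3
  have h1 : 2 * (s + 1) + 1 ≤ y ^ 2 := by nlinarith
  unfold productSize
  calc 5 * ((D + 1) * (p.vars.card + 1)) * (6 * (2 * (s + 1) + 1) ^ 2) ^ (Nat.log 2 D + 2)
      ≤ y ^ 3 * (y * y) * (y ^ 3 * (y ^ 2) ^ 2) ^ (Nat.log 2 D + 2) := by
        gcongr <;> omega
    _ = y ^ (5 + 7 * (Nat.log 2 D + 2)) := by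
        rw [pow_add y, pow_mul y, show y ^ 3 * (y * y) = y ^ 5 by ring,
          show y ^ 3 * (y ^ 2) ^ 2 = y ^ 7 by ring]
    -- With `L = Nat.log 2 D`, `5 + 7 * (L + 2) = 19 + 7 * L`, whence the constant 19.
    _ ≤ y ^ (19 * (Nat.log 2 D + 1)) := Nat.pow_le_pow_right (by omega) (by omega)

theorem VQ3F_subset_VQ3P : VQ3F ⊆ VQ3P := by
  rintro f ⟨hf, c, hc, hL⟩
  exact ⟨hf, c, hc, fun n => (hL n).gradedCircuitSizeLE⟩

theorem VQ3P_subset_VQP : VQ3P ⊆ VQP :=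
  quasiPolyClass_subset 5 fun _ s h => ⟨9 * s, nine_mul_le s _ _, h.circuitSizeLE⟩

theorem VQ3F_subset_VQF : VQ3F ⊆ VQF :=
  quasiPolyClass_subset 5 fun _ s h => ⟨9 * s, nine_mul_le s _ _, h.formulaSizeLE⟩

theorem VQF_subset_VQP : VQF ⊆ VQP := by
  rintro f ⟨hf, c, hc, hL⟩
  exact ⟨hf, c, hc, fun n => (hL n).circuitSizeLE⟩

end ArithComplexity

theorem mainTheorem5 :
    ArithComplexity.VQ3F = ArithComplexity.VQ3P ∧
    ArithComplexity.VQ3F = ArithComplexity.VQF ∧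
    ArithComplexity.VQF = ArithComplexity.VQBP ∧
    ArithComplexity.VQBP = ArithComplexity.VQP ∧
    ArithComplexity.VQP = ArithComplexity.VQ3P := by
  open ArithComplexity in
  have hP3F : VQP ⊆ VQ3F := VQP_subset_VQBP.trans VQBP_subset_VQ3F
  have hP : VQ3F = VQP := (VQ3F_subset_VQ3P.trans VQ3P_subset_VQP).antisymm hP3F
  have hF : VQF = VQP := VQF_subset_VQP.antisymm (hP3F.trans VQ3F_subset_VQF)
  have hBP : VQBP = VQP := (VQBP_subset_VQ3F.trans hP.le).antisymm VQP_subset_VQBP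
  have h3P : VQ3P = VQP := VQ3P_subset_VQP.antisymm (hP3F.trans VQ3F_subset_VQ3P)
  rw [hP, hF, hBP, h3P]
  simp
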